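/- Let $\mathcal E,\mathcal A,\mathcal B$ be finite sets, let $\mu$ be a common prior on $\mathcal E\times\mathcal A\times\mathcal B$ for the event $E$, Alice's signal $A$ and Bob's signal $B$, and let $R:\Delta(\mathcal E)\times\mathcal E\to\mathbb R$ be a strictly proper scoring rule (real-valued) whose expected score function $G(w)=\sum_e w_eR(w,e)$ is differentiable on $\Delta(\mathcal E)$ (at boundary points, relative to the simplex). A signaling scheme is a function $\pi:\mathcal S\times\mathcal A\to[0,1]$ with $\sum_s\pi(s,a)=\Pr[A=a]$ for all $a$, where $\mathcal S$ is any set; $\pi(s,a)=\Pr[S=s,A=a]$, and $S$ is independent of $(B,E)$ given $A$. Let $\mathbf p_s$ and $\mathbf p_{s,b}$ be the posteriors on $E$ given $S=s$ and given $S=s,B=b$. Bob's utility in the Alice-Bob-Alice game with commitment is $u_B(\pi;\pi)=\mathbb E[R(\mathbf p_{S,B},E)-R(\mathbf p_S,E)]$. Let $\pi^*$ be a scheme, with signal space $\mathcal S$, that minimizes $u_B(\pi;\pi)$ over all signaling schemes (with all signal spaces). In the Alice-Bob-Alice prediction market (without commitment) with initial prediction $\mathbf p^0\in\Delta(\mathcal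 E)$, Alice, knowing $A$, reports $\mathbf p^1\in\Delta(\mathcal E)$; then Bob, knowing $B$ and $\mathbf p^1$, reports $\mathbf p^2$; then Alice, knowing $A,\mathbf p^1,\mathbf p^2$, reports $\mathbf p^3$. Reports may be randomized (finitely supported lotteries). The reporter of $\mathbf p^t$ is paid $R(\mathbf p^t,E)-R(\mathbf p^{t-1},E)$. An $\epsilon$-perfect Bayesian equilibrium is a strategy profile together with beliefs of Bob about $A$ at each $(B,\mathbf p^1)$ and of Alice about $B$ at each $(A,\mathbf p^1,\mathbf p^2)$ such that 1. no player can gain more than $\epsilon$ in ex ante expected utility by a unilateral deviation; 2. at every information set, on or off the path, whose own signal has positive prior probability, the moving player's continuation strategy is within $\epsilon$ of optimal under her belief (in round 1, Alice's belief is the prior conditioned on $A$); 3. the beliefs are Bayesian updates of the prior, given the player's own signal, on information about the opponent's signal alone. That information is the opponent's last report, read through the opponent's strategy after that history, whenever some opponent signal of positive prior probability makes this report with positive probability; otherwise it is given by an arbitrary likelihood function of the opponent's signal (positive at some signal of positive prior probability) that does not depend on the player's own signal. Where the information has probability zero given the player's own signal, the belief is only required to charge no opponent signal that the own signal excludes.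 Then for every $\epsilon>0$ there are an $\epsilon$-perfect Bayesian equilibrium of this market and a signaling scheme $\pi:\mathcal S\times\mathcal A\to[0,1]$ with $\sum_{s,a}|\pi(s,a)-\pi^*(s,a)|\le\epsilon$ such that, in this equilibrium, Alice plays $\pi$ in round 1: having observed $a$ she draws $s$ with probability $\pi(s,a)/\Pr[A=a]$ and reports the posterior $\mathbf p_s$ computed from $\pi$. -/

import Mathlib

namespace ABA

noncomputable section

/-- Probability vectors on a finite set: the simplex `Δ(X)`. -/
abbrev ProbVec (X : Type*) [Fintype X] := stdSimplex ℝ X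

/-- Finitely supported lotteries over an arbitrary set, used for randomized play. -/
abbrev Lottery (X : Type*) := Convexity.StdSimplex ℝ X

/-- The expectation of `f` under a lottery. -/
def Lottery.expect {X : Type*} (L : Lottery X) (f : X → ℝ) : ℝ :=
  L.weights.sum fun x w => w * f x

/-! ### Scoring rules -/

/-- `R(w'; w)`: the expected score of the prediction `w'` when the event is drawn from `w`. -/
def expScore {E : Type*} [Fintype E] (R : ProbVec E → E → ℝ) (w' w : ProbVec E) : ℝ :=
  ∑ e, w e * R w' e

/-- Strict properness: the true belief is the unique maximizer of the expected score. -/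
def StrictlyProper {E : Type*} [Fintype E] (R : ProbVec E → E → ℝ) : Prop :=
  ∀ w w' : ProbVec E, w ≠ w' → expScore R w' w < expScore R w w

/-! ### The prior -/

section Prior

variable {E A B : Type*} [Fintype E] [Fintype A] [Fintype B]

/-- `Pr[A = a]`. -/
def probA (μ : ProbVec (E × A × B)) (a : A) : ℝ := ∑ e, ∑ b, μ (e, a, b)

/-- `Pr[B = b]`. -/
def probB (μ : ProbVec (E × A × B)) (b : B) : ℝ := ∑ e, ∑ a, μ (e, a, b)

/-- `Pr[A = a, B = b]`. -/
def probAB (μ : ProbVec (E × A × B)) (a : A) (b : B) : ℝ := ∑ e, μ (e, a, b)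

/-- `Pr[E = e, B = b | A = a]` (only used when `Pr[A = a] > 0`, or with weight zero). -/
def condEB (μ : ProbVec (E × A × B)) (a : A) (e : E) (b : B) : ℝ := μ (e, a, b) / probA μ a

/-- `Pr[E = e | A = a, B = b]` (only used when `Pr[A = a, B = b] > 0`, or with weight zero). -/
def condE (μ : ProbVec (E × A × B)) (a : A) (b : B) (e : E) : ℝ := μ (e, a, b) / probAB μ a b

end Prior

open Classical in
/-- The probability vector proportional to a nonnegative vector `x ≠ 0`
(an arbitrary one if `x` cannot be normalized). -/
def normalizeVec {X : Type*} [Fintype X] [Nonempty X] (x : X → ℝ) : ProbVec X :=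
  if h : (fun i => x i / ∑ j, x j) ∈ stdSimplex ℝ X then ⟨_, h⟩ else Classical.arbitrary _

/-! ### Signaling schemes and the game with commitment -/

/-- A signaling scheme `π(s, a) = Pr[S = s, A = a]` with an arbitrary signal space. -/
structure SignalingScheme {E A B : Type*} [Fintype E] [Fintype A] [Fintype B]
    (μ : ProbVec (E × A × B)) (S : Type*) where
  prob : S → A → ℝ
  nonneg : ∀ s a, 0 ≤ prob s a
  marginal : ∀ a, HasSum (fun s => prob s a) (probA μ a)

section Commitment

variable {E A B S : Type*} [Fintype E] [Fintype A] [Fintype B] {μ : ProbVec (E × A × B)}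

/-- `Pr[S = s, A = a, B = b, E = e]`; given `A`, the signal `S` is independent of `(B, E)`. -/
def SignalingScheme.joint (π : SignalingScheme μ S) (s : S) (e : E) (a : A) (b : B) : ℝ :=
  π.prob s a * condEB μ a e b

variable [Nonempty E]

/-- `p_s`: the posterior on the event given `S = s`. -/
def SignalingScheme.postS (π : SignalingScheme μ S) (s : S) : ProbVec E :=
  normalizeVec fun e => ∑ a, ∑ b, π.joint s e a b

/-- `p_{s,b}`: the posterior on the event given `S = s` and `B = b`. -/
def SignalingScheme.postSB (π : SignalingScheme μ S) (s : S) (b : B) : ProbVec E :=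
  normalizeVec fun e => ∑ a, π.joint s e a b

/-- `u_B(π; π) = E[R(p_{S,B}, E) - R(p_S, E)]`: Bob's expected utility in the game with
commitment. -/
def commitUtilityBob (R : ProbVec E → E → ℝ) (π : SignalingScheme μ S) : ℝ :=
  ∑' s, ∑ e, ∑ a, ∑ b, π.joint s e a b * (R (π.postSB s b) e - R (π.postS s) e)

/-- `π` minimizes Bob's utility among all signaling schemes, with any signal space. As only
countably many signals have positive probability, signal spaces in `Type` are enough. -/
def IsOptimalScheme (R : ProbVec E → E → ℝ) (π : SignalingScheme μ S) : Prop :=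
  ∀ (T : Type) (τ : SignalingScheme μ T), commitUtilityBob R π ≤ commitUtilityBob R τ

end Commitment

/-! ### The Alice-Bob-Alice prediction market -/

/-- Alice's behaviour in round 1, as a function of her signal. -/
abbrev Strategy1 (E A : Type*) [Fintype E] := A → Lottery (ProbVec E)

/-- Bob's behaviour in round 2, as a function of his signal and `p¹`. -/
abbrev Strategy2 (E B : Type*) [Fintype E] := B → ProbVec E → Lottery (ProbVec E)

/-- Alice's behaviour in round 3, as a function of her signal, `p¹` and `p²`. -/
abbrev Strategy3 (E A : Type*) [Fintype E] := A → ProbVec E → ProbVec E → Lottery (ProbVec E)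

section Market

variable {E A B : Type*} [Fintype E] [Fintype A] [Fintype B]

/-- Alice's payment over rounds 1 and 3 when the event turns out to be `e`. -/
def alicePayoff (R : ProbVec E → E → ℝ) (p0 p1 p2 p3 : ProbVec E) (e : E) : ℝ :=
  (R p1 e - R p0 e) + (R p3 e - R p2 e)

/-- Bob's payment in round 2 when the event turns out to be `e`. -/
def bobPayoff (R : ProbVec E → E → ℝ) (p1 p2 : ProbVec E) (e : E) : ℝ := R p2 e - R p1 e

/-- Alice's ex ante expected utility `u_A`. -/
def utilityAlice (μ : ProbVec (E × A × B)) (R : ProbVec E → E → ℝ) (p0 : ProbVec E)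
    (σ1 : Strategy1 E A) (σ3 : Strategy3 E A) (σ2 : Strategy2 E B) : ℝ :=
  ∑ e, ∑ a, ∑ b, μ (e, a, b) *
    (σ1 a).expect fun p1 => (σ2 b p1).expect fun p2 => (σ3 a p1 p2).expect fun p3 =>
      alicePayoff R p0 p1 p2 p3 e

/-- Bob's ex ante expected utility `u_B` (round 3 does not affect it). -/
def utilityBob (μ : ProbVec (E × A × B)) (R : ProbVec E → E → ℝ)
    (σ1 : Strategy1 E A) (σ2 : Strategy2 E B) : ℝ :=
  ∑ e, ∑ a, ∑ b, μ (e, a, b) *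
    (σ1 a).expect fun p1 => (σ2 b p1).expect fun p2 => bobPayoff R p1 p2 e

/-- Alice's expected utility at the start of round 1, given her signal `a`, from reporting
according to `q` in round 1 and according to `τ` in round 3. -/
def interimAlice1 (μ : ProbVec (E × A × B)) (R : ProbVec E → E → ℝ) (p0 : ProbVec E)
    (σ2 : Strategy2 E B) (a : A) (q : Lottery (ProbVec E))
    (τ : ProbVec E → ProbVec E → Lottery (ProbVec E)) : ℝ :=
  ∑ e, ∑ b, condEB μ a e b *
    q.expect fun p1 => (σ2 b p1).expect fun p2 => (τ p1 p2).expect fun p3 =>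
      alicePayoff R p0 p1 p2 p3 e

/-- Bob's expected utility in round 2, given his signal `b`, the report `p¹` and a belief `β`
on Alice's signal, from reporting according to `q`. -/
def interimBob (μ : ProbVec (E × A × B)) (R : ProbVec E → E → ℝ) (b : B) (p1 : ProbVec E)
    (β : ProbVec A) (q : Lottery (ProbVec E)) : ℝ :=
  ∑ a, β a * ∑ e, condE μ a b e * q.expect fun p2 => bobPayoff R p1 p2 e

/-- Alice's expected utility in round 3, given her signal `a`, the reports `p¹`, `p²` and a
belief `α` on Bob's signal, from reporting according to `q`. -/
def interimAlice3 (μ : ProbVec (E × A × B)) (R : ProbVec E → E → ℝ) (p0 : ProbVec E) (a : A)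
    (p1 p2 : ProbVec E) (α : ProbVec B) (q : Lottery (ProbVec E)) : ℝ :=
  ∑ b, α b * ∑ e, condE μ a b e * q.expect fun p3 => alicePayoff R p0 p1 p2 p3 e

/-- `β` is a Bayesian update of the prior with (unnormalized) weights `w` on information with
likelihood `ℓ`: Bayes' rule holds whenever that information has positive probability, and `β`
never charges points that the prior excludes. -/
def IsBayesUpdate {X : Type*} [Fintype X] (w ℓ : X → ℝ) (β : ProbVec X) : Prop :=
  (∀ x, w x = 0 → β x = 0) ∧ ∀ x, (∑ y, w y * ℓ y) * β x = w x * ℓ x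

/-- A system of beliefs, consistent with `σ1` and `σ2`. After every history, a player's belief is
the Bayesian update, on her own signal, of the common prior and of information about the opponent's
signal alone. This information is the opponent's last report, interpreted by the opponent's strategy
whenever some signal of the opponent makes that report with positive probability; otherwise it
is arbitrary (but the same for all of the player's own signals). -/
structure ConsistentBeliefs (μ : ProbVec (E × A × B)) (σ1 : Strategy1 E A) (σ2 : Strategy2 E B)
    (β : B → ProbVec E → ProbVec A) (α : A → ProbVec E → ProbVec E → ProbVec B) : Prop where
  bob : ∀ p1, ∃ ℓ : A → ℝ, (∀ a, 0 ≤ ℓ a) ∧ (∃ a, 0 < probA μ a ∧ 0 < ℓ a) ∧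
    ((∃ a, 0 < probA μ a ∧ 0 < (σ1 a).weights p1) → ∀ a, ℓ a = (σ1 a).weights p1) ∧
    ∀ b, 0 < probB μ b → IsBayesUpdate (fun a => probAB μ a b) ℓ (β b p1)
  alice : ∀ p1 p2, ∃ ℓ : B → ℝ, (∀ b, 0 ≤ ℓ b) ∧ (∃ b, 0 < probB μ b ∧ 0 < ℓ b) ∧
    ((∃ b, 0 < probB μ b ∧ 0 < (σ2 b p1).weights p2) → ∀ b, ℓ b = (σ2 b p1).weights p2) ∧
    ∀ a, 0 < probA μ a → IsBayesUpdate (fun b => probAB μ a b) ℓ (α a p1 p2)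

/-- An `ε`-perfect Bayesian equilibrium: an `ε`-Bayes-Nash equilibrium together with consistent
beliefs such that, at every information set, on or off the equilibrium path, the continuation
strategy of the player who moves is a best response up to `ε` under these beliefs.
Signals of prior probability zero are never observed and impose nothing. -/
structure IsEpsPBE (μ : ProbVec (E × A × B)) (R : ProbVec E → E → ℝ) (p0 : ProbVec E) (ε : ℝ)
    (σ1 : Strategy1 E A) (σ3 : Strategy3 E A) (σ2 : Strategy2 E B)
    (β : B → ProbVec E → ProbVec A) (α : A → ProbVec E → ProbVec E → ProbVec B) : Prop where
  bne_alice : ∀ σ1' σ3', utilityAlice μ R p0 σ1' σ3' σ2 ≤ utilityAlice μ R p0 σ1 σ3 σ2 + ε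
  bne_bob : ∀ σ2', utilityBob μ R σ1 σ2' ≤ utilityBob μ R σ1 σ2 + ε
  consistent : ConsistentBeliefs μ σ1 σ2 β α
  rational_alice1 : ∀ a, 0 < probA μ a → ∀ q τ,
    interimAlice1 μ R p0 σ2 a q τ ≤ interimAlice1 μ R p0 σ2 a (σ1 a) (σ3 a) + ε
  rational_bob : ∀ b, 0 < probB μ b → ∀ p1 q,
    interimBob μ R b p1 (β b p1) q ≤ interimBob μ R b p1 (β b p1) (σ2 b p1) + ε
  rational_alice3 : ∀ a, 0 < probA μ a → ∀ p1 p2 q,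
    interimAlice3 μ R p0 a p1 p2 (α a p1 p2) q ≤
      interimAlice3 μ R p0 a p1 p2 (α a p1 p2) (σ3 a p1 p2) + ε

open Classical in
/-- In round 1 Alice plays the scheme `π`: having observed `a`, she draws `S` from `π(· | a)` and
reports the posterior `p_S`. -/
def PlaysScheme [Nonempty E] {S : Type*} {μ : ProbVec (E × A × B)} (σ1 : Strategy1 E A)
    (π : SignalingScheme μ S) : Prop :=
  ∀ a, 0 < probA μ a → ∀ p : ProbVec E,
    HasSum (fun s => if π.postS s = p then π.prob s a / probA μ a else 0) ((σ1 a).weights p)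

end Market

/-- The `ℓ¹` distance between two schemes with the same signal space. -/
def schemeDist {E A B S : Type*} [Fintype E] [Fintype A] [Fintype B] {μ : ProbVec (E × A × B)}
    (π π' : SignalingScheme μ S) : ℝ :=
  ∑' s, ∑ a, |π.prob s a - π'.prob s a|

end

end ABA

/-!
A signal that type `a` of Alice sends with probability `x a` is represented by its likelihood
vector `x`. Bob's gain from it, `bobGain μ R x`, is positively homogeneous, and a signaling scheme
is a way of writing the all-ones vector as a sum of likelihood vectors. Convex duality
(`exists_supporting_price`) therefore attaches prices `l a` to an optimal scheme: every vector
satisfies `∑ a, l a * x a ≤ bobGain μ R x`, with equality at every signal of the scheme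
(`RegularScore.exists_price_of_isOptimalScheme`). Suppose that type `a` reports `p`, that Bob
answers with the posterior that some likelihood vector `x` induces, and that Alice then reports
the posterior given all signals. Then type `a` obtains her full-information value minus
`devCost μ R x p a`. The prices are what the types lose in equilibrium, so it has to be shown that
Bob can make inferences under which type `a` loses at least almost `l a` after every report.

* Off the path, every report `p` can be answered by such an inference
  (`RegularScore.exists_deterring_likelihood`). The function `∑ a, x a * devCost μ R x p a` of `x`
  is convex, homogeneous, and at least `bobGain μ R x`, hence at least `∑ a, l a * x a`.
  Minimizing the difference on the simplex with a logarithmic barrier yields a vector `x` of full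
  support, at which the first-order condition says that no type is more than `ε` below her price.
* On the path, a type that does not send a signal might lose less than her price by imitating it,
  since the scoring rule may be discontinuous, even unbounded, where probabilities vanish. The
  optimal scheme is therefore replaced by a nearby scheme of full support. It minimizes Bob's
  total gain plus a small multiple of the distance to the optimal scheme, again with a logarithmic
  barrier. Moving mass of type `a` from one signal to another cannot help, so her cost at no
  signal is much smaller than at one that she sends with substantial probability
  (`RegularScore.exists_perturbation_exchange`). At a signal that she sends in the optimal scheme
  her cost is at least `l a` (`RegularScore.price_le_devCost_of_tight`) and remains almost so
  nearby; hence at every signal she pays at least almost `l a`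
  (`RegularScore.exists_perturbation`).

Both steps use that `R · e` is continuous at beliefs that give `e` positive probability, which is
what the differentiability of the expected score function provides
(`tendsto_score_of_differentiableOn`).

Two adjustments connect this with arbitrary signal spaces
(`RegularScore.exists_fullSupport_scheme`). An infinite scheme is close to a reweighting of
finitely many of its signals (`exists_finite_reweighting`). As Bob sees only Alice's report,
signals with the same posterior act as one; they are merged before the perturbation
(`RegularScore.bobGain_sum_of_post_eq`), so that different merged signals keep different
posteriors, and the perturbed merged signals are split again into signals with a common posterior.

In the equilibrium (`RegularScore.exists_isEpsPBE`) Bob does not report exactly his posterior but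
a prediction nearby that reveals his signal (`RegularScore.exists_revealing_reports`), so that
Alice's last report can indeed be the posterior given all signals. All errors are controlled by
`ε`.
-/

namespace ABA

noncomputable section

open Filter Topology

set_option linter.unusedSectionVars false

/-! ### Normalization and the optimal expected score -/

section Score

variable {X E : Type*} [Fintype X] [Nonempty X] [Fintype E] [Nonempty E]

theorem normalizeVec_apply {x : X → ℝ} (hx : 0 ≤ x) (hs : 0 < ∑ j, x j) (i : X) :
    normalizeVec x i = x i / ∑ j, x j := by
  have h : (fun i => x i / ∑ j, x j) ∈ stdSimplex ℝ X :=
    ⟨fun i => div_nonneg (hx i) hs.le, by rw [← Finset.sum_div, div_self hs.ne']⟩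
  simp only [normalizeVec, dif_pos h]
  rfl

theorem sum_mul_normalizeVec {x : X → ℝ} (hx : 0 ≤ x) (i : X) :
    (∑ j, x j) * normalizeVec x i = x i := by
  rcases (Finset.sum_nonneg fun j _ => hx j).eq_or_lt with h | h
  · have := (Finset.sum_eq_zero_iff_of_nonneg fun j _ => hx j).1 h.symm i (Finset.mem_univ i)
    rw [← h, this, zero_mul]
  · rw [normalizeVec_apply hx h, mul_div_cancel₀ _ h.ne']

theorem normalizeVec_smul {c : ℝ} (hc : c ≠ 0) (x : X → ℝ) :
    normalizeVec (fun i => c * x i) = normalizeVec x := by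
  have h : (fun i => c * x i / ∑ j, c * x j) = fun i => x i / ∑ j, x j := by
    simp only [← Finset.mul_sum, mul_div_mul_left _ _ hc]
  have key : ∀ u v : X → ℝ, u = v →
      (open Classical in if h : u ∈ stdSimplex ℝ X then (⟨u, h⟩ : ProbVec X)
        else Classical.arbitrary _) =
      (open Classical in if h : v ∈ stdSimplex ℝ X then (⟨v, h⟩ : ProbVec X)
        else Classical.arbitrary _) := by
    rintro u _ rfl
    rfl
  exact key _ _ h

theorem normalizeVec_eq_of_forall_mul {x : X → ℝ} {c : ℝ} (hc : 0 < c) (p : ProbVec X)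
    (h : ∀ i, x i = c * p i) : normalizeVec x = p := by
  have hs : ∑ j, x j = c := by simp [h, ← Finset.mul_sum]
  have hx : 0 ≤ x := fun i => by rw [h]; exact mul_nonneg hc.le (p.2.1 i)
  ext i
  rw [normalizeVec_apply hx (hs ▸ hc), hs, h, mul_div_cancel_left₀ _ hc.ne']

theorem tendsto_normalizeVec {x : X → ℝ} (hx : 0 ≤ x) (hs : 0 < ∑ j, x j) :
    Tendsto (normalizeVec (X := X)) (𝓝[{y | 0 ≤ y}] x) (𝓝 (normalizeVec x)) := by
  rw [tendsto_subtype_rng]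
  have hcont : ContinuousAt (fun y : X → ℝ => fun i => y i / ∑ j, y j) x := by
    refine continuousAt_pi.2 fun i => ?_
    exact (continuous_apply i).continuousAt.div (by fun_prop) hs.ne'
  have hval : (normalizeVec x).1 = fun i => x i / ∑ j, x j := by
    ext i; exact normalizeVec_apply hx hs i
  rw [hval]
  refine (hcont.tendsto.mono_left nhdsWithin_le_nhds).congr' ?_
  have hpos : ∀ᶠ y in 𝓝[{y | 0 ≤ y}] x, 0 < ∑ j, y j := by
    have : ContinuousAt (fun y : X → ℝ => ∑ j, y j) x := by fun_prop
    exact nhdsWithin_le_nhds (this.eventually_const_lt hs)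
  filter_upwards [hpos, self_mem_nhdsWithin] with y hy hy0
  ext i
  exact (normalizeVec_apply hy0 hy i).symm

/-- The properties of a scoring rule that the equilibrium construction rests on: the true belief is
an optimal prediction, the optimal expected score is continuous, and `R · e` is continuous at every
belief that gives `e` positive probability. -/
structure RegularScore (R : ProbVec E → E → ℝ) : Prop where
  proper : ∀ w w' : ProbVec E, expScore R w' w ≤ expScore R w w
  continuous : Continuous fun w : ProbVec E => expScore R w w
  tendsto : ∀ (w : ProbVec E) (e : E), 0 < w e → Tendsto (fun w' => R w' e) (𝓝 w) (𝓝 (R w e))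

/-- The point at parameter `t` on the line from `w` (at `t = 0`) to the vertex `e` (at `t = 1`). -/
def towardVertex (e : E) (t : ℝ) (w : E → ℝ) : E → ℝ :=
  open Classical in fun i => w i + t * ((if i = e then 1 else 0) - w i)

theorem towardVertex_mem {e : E} {t : ℝ} {w : E → ℝ} (hw : w ∈ stdSimplex ℝ E) (ht : t ≤ 1)
    (ht' : -w e ≤ t) : towardVertex e t w ∈ stdSimplex ℝ E := by
  classical
  have h1 := hw.2
  constructor
  · intro i
    have hi := hw.1 i
    have hi1 : w i ≤ 1 := (mem_Icc_of_mem_stdSimplex hw i).2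
    by_cases h : i = e
    · subst h
      simp only [towardVertex, if_true]
      rcases le_or_gt 0 t with h0 | h0 <;> nlinarith
    · simp only [towardVertex, if_neg h]
      nlinarith
  · simp only [towardVertex, Finset.sum_add_distrib, ← Finset.mul_sum, Finset.sum_sub_distrib, h1]
    simp

/-- Convexity and differentiability of the expected score function `G` make `w' ↦ R w' e` continuous
at every `w` with `w e > 0`: the number `R w' e - G w'` is a slope of `G` on the line through `w'`
and the vertex `e`, and this line can be prolonged beyond `w'` by an amount that is uniform for `w'`
near `w`, so the slopes are squeezed between difference quotients of `G` at `w`. -/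
theorem tendsto_score_of_differentiableOn {R : ProbVec E → E → ℝ}
    (hR : ∀ w w' : ProbVec E, expScore R w' w ≤ expScore R w w)
    {G : (E → ℝ) → ℝ} (hG : ∀ w : ProbVec E, G w = expScore R w w)
    (hGdiff : DifferentiableOn ℝ G (stdSimplex ℝ E)) {w : ProbVec E} {e : E} (he : 0 < w e) :
    Tendsto (fun w' => R w' e) (𝓝 w) (𝓝 (R w e)) := by
  classical
  -- `R w' e - G w'` is a slope of `G` at `w'` along the line towards `e`
  have hsub : ∀ (w' : ProbVec E) (t : ℝ), t ≤ 1 → -w' e ≤ t →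
      G w' + t * (R w' e - G w') ≤ G (towardVertex e t w') := by
    intro w' t ht ht'
    have hm := towardVertex_mem w'.2 ht ht'
    have h := hR ⟨_, hm⟩ w'
    rw [← hG] at h
    refine le_trans (le_of_eq ?_) h
    rw [hG]
    have h1 : expScore R w' ⟨_, hm⟩ = ∑ i, (w' i * R w' i + t * ((if i = e then R w' i else 0)
        - w' i * R w' i)) := by
      refine Finset.sum_congr rfl fun i _ => ?_
      change towardVertex e t w' i * R w' i = _
      simp only [towardVertex]
      split_ifs <;> ring
    rw [h1, Finset.sum_add_distrib, ← Finset.mul_sum, Finset.sum_sub_distrib]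
    simp [expScore]
  have hcont : ∀ t : ℝ, t ≤ 1 → -w e < t →
      Tendsto (fun w' : ProbVec E => G w' + (G (towardVertex e t w') - G w') / t) (𝓝 w)
        (𝓝 (G w + (G (towardVertex e t w) - G w) / t)) := by
    intro t ht ht'
    have hG1 : Tendsto (fun w' : ProbVec E => G w') (𝓝 w) (𝓝 (G w)) :=
      (hGdiff.continuousOn.domRestrict.tendsto w)
    have hG2 : Tendsto (fun w' : ProbVec E => G (towardVertex e t w')) (𝓝 w)
        (𝓝 (G (towardVertex e t w))) := by
      refine (hGdiff.continuousOn _ (towardVertex_mem w.2 ht ht'.le)).tendsto.comp ?_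
      refine tendsto_nhdsWithin_iff.2 ⟨?_, ?_⟩
      · have : Continuous fun w' : ProbVec E => towardVertex e t w' := by
          refine continuous_pi fun i => ?_
          simp only [towardVertex]
          have : Continuous fun w' : ProbVec E => (w' : E → ℝ) i :=
            (continuous_apply i).comp continuous_subtype_val
          exact this.add (continuous_const.mul (continuous_const.sub this))
        exact this.tendsto w
      · have : Continuous fun w' : ProbVec E => -(w' : E → ℝ) e :=
          ((continuous_apply e).comp continuous_subtype_val).neg
        filter_upwards [this.continuousAt.eventually_lt_const ht'] with w' hw'
        exact towardVertex_mem w'.2 ht (le_of_lt hw')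
    exact hG1.add ((hG2.sub hG1).div_const t)
  -- the two-sided derivative of `G` along the line through `w` and the vertex `e`
  obtain ⟨D, hD⟩ : ∃ D, HasDerivAt (fun t => G (towardVertex e t w)) D 0 := by
    have h0 : towardVertex e 0 (w : E → ℝ) = w := by ext; simp [towardVertex]
    obtain ⟨G', hG'⟩ := hGdiff w w.2
    have hline : HasDerivAt (fun t => towardVertex e t (w : E → ℝ))
        (fun i => (if i = e then 1 else 0) - w i) 0 := by
      refine hasDerivAt_pi.2 fun i => ?_
      simp only [towardVertex]
      simpa using ((hasDerivAt_id (0 : ℝ)).mul_const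
        ((if i = e then (1 : ℝ) else 0) - w i)).const_add (w i)
    have hmaps : Set.MapsTo (fun t => towardVertex e t (w : E → ℝ)) (Set.Icc (-w e) 1)
        (stdSimplex ℝ E) := fun t ht => towardVertex_mem w.2 ht.2 ht.1
    have := (h0.symm ▸ hG' : HasFDerivWithinAt G G' (stdSimplex ℝ E)
      (towardVertex e 0 w)).comp_hasDerivWithinAt (0 : ℝ) hline.hasDerivWithinAt hmaps
    exact ⟨_, this.hasDerivAt (Icc_mem_nhds (by linarith) one_pos)⟩
  have h0 : towardVertex e 0 (w : E → ℝ) = w := by ext; simp [towardVertex]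
  have hslope := hasDerivAt_iff_tendsto_slope.1 hD
  have hslope' : ∀ t, slope (fun t => G (towardVertex e t w)) 0 t
      = (G (towardVertex e t w) - G w) / t := by
    intro t; simp [slope_def_field, h0]
  have hpos : Tendsto (fun t => G w + (G (towardVertex e t w) - G w) / t) (𝓝[>] 0)
      (𝓝 (G w + D)) := by
    refine tendsto_const_nhds.add ?_
    refine (hslope.mono_left (nhdsWithin_mono _ fun t ht => ne_of_gt ht)).congr hslope'
  have hneg : Tendsto (fun t => G w + (G (towardVertex e t w) - G w) / t) (𝓝[<] 0)
      (𝓝 (G w + D)) := by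
    refine tendsto_const_nhds.add ?_
    refine (hslope.mono_left (nhdsWithin_mono _ fun t ht => ne_of_lt ht)).congr hslope'
  have hub : ∀ (w' : ProbVec E) (t : ℝ), t ≤ 1 → 0 < t →
      R w' e ≤ G w' + (G (towardVertex e t w') - G w') / t := by
    intro w' t ht ht0
    have h := hsub w' t ht (by linarith [w'.2.1 e, show w' e = w'.1 e from rfl])
    have : R w' e - G w' ≤ (G (towardVertex e t w') - G w') / t := by
      rw [le_div_iff₀ ht0]; linarith
    linarith
  have hlb : ∀ (w' : ProbVec E) (t : ℝ), t < 0 → -w' e ≤ t →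
      G w' + (G (towardVertex e t w') - G w') / t ≤ R w' e := by
    intro w' t ht ht0
    have h := hsub w' t (by linarith) ht0
    have : (G (towardVertex e t w') - G w') / t ≤ R w' e - G w' := by
      rw [div_le_iff_of_neg ht]; linarith
    linarith
  have ev1 : ∀ᶠ t : ℝ in 𝓝[>] 0, t ≤ 1 := nhdsWithin_le_nhds (eventually_le_nhds one_pos)
  have ev2 : ∀ᶠ t : ℝ in 𝓝[<] 0, -w e < t :=
    nhdsWithin_le_nhds (eventually_gt_nhds (by linarith))
  have hRD : R w e = G w + D := by
    apply le_antisymm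
    · refine ge_of_tendsto hpos ?_
      filter_upwards [ev1, self_mem_nhdsWithin] with t ht ht0 using hub w t ht ht0
    · refine le_of_tendsto hneg ?_
      filter_upwards [ev2, self_mem_nhdsWithin] with t ht ht0 using hlb w t ht0 ht.le
  refine tendsto_order.2 ⟨fun a ha => ?_, fun a ha => ?_⟩
  · rw [hRD] at ha
    obtain ⟨t, h1, h2, h3⟩ :=
      ((hneg.eventually_const_lt ha).and (ev2.and self_mem_nhdsWithin)).exists
    have hwe : Continuous fun w' : ProbVec E => -(w' : E → ℝ) e :=
      ((continuous_apply e).comp continuous_subtype_val).neg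
    filter_upwards [(hcont t (by linarith [show t < 0 from h3]) h2).eventually_const_lt h1,
      hwe.continuousAt.eventually_lt_const h2] with w' h4 h5
    exact h4.trans_le (hlb w' t h3 h5.le)
  · rw [hRD] at ha
    obtain ⟨t, h1, h2, h3⟩ :=
      ((hpos.eventually_lt_const ha).and (ev1.and self_mem_nhdsWithin)).exists
    filter_upwards [(hcont t h2 (by linarith [show 0 < t from h3])).eventually_lt_const h1]
      with w' h4
    exact (hub w' t h2 h3).trans_lt h4

theorem regularScore_of_differentiableOn {R : ProbVec E → E → ℝ} (hR : StrictlyProper R)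
    {G : (E → ℝ) → ℝ} (hG : ∀ w : ProbVec E, G w = expScore R w w)
    (hGdiff : DifferentiableOn ℝ G (stdSimplex ℝ E)) : RegularScore R := by
  have hp : ∀ w w' : ProbVec E, expScore R w' w ≤ expScore R w w := fun w w' => by
    rcases eq_or_ne w w' with rfl | h
    · exact le_rfl
    · exact (hR w w' h).le
  refine ⟨hp, ?_, fun w e he => tendsto_score_of_differentiableOn hp hG hGdiff he⟩
  have := hGdiff.continuousOn.domRestrict
  refine this.congr fun w => ?_
  exact hG w

/-- The expected score of the optimal prediction against a nonnegative weight vector `x`, which need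
not be normalized: the positively homogeneous extension of the expected score function. -/
def score (R : ProbVec E → E → ℝ) (x : E → ℝ) : ℝ := ∑ e, x e * R (normalizeVec x) e

variable {R : ProbVec E → E → ℝ}

theorem sum_mul_eq_expScore {x : E → ℝ} (hx : 0 ≤ x) (p : ProbVec E) :
    ∑ e, x e * R p e = (∑ e, x e) * expScore R p (normalizeVec x) := by
  rw [expScore, Finset.mul_sum]
  refine Finset.sum_congr rfl fun e _ => ?_
  rw [← mul_assoc, sum_mul_normalizeVec hx]

theorem RegularScore.sum_mul_le_score (h : RegularScore R) {x : E → ℝ} (hx : 0 ≤ x)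
    (p : ProbVec E) : ∑ e, x e * R p e ≤ score R x := by
  rw [score, sum_mul_eq_expScore hx, sum_mul_eq_expScore hx]
  exact mul_le_mul_of_nonneg_left (h.proper _ _) (Finset.sum_nonneg fun e _ => hx e)

theorem score_smul {c : ℝ} (hc : 0 ≤ c) (x : E → ℝ) :
    score R (fun e => c * x e) = c * score R x := by
  rcases hc.eq_or_lt with rfl | hc
  · simp [score]
  · simp only [score, normalizeVec_smul hc.ne', Finset.mul_sum, mul_assoc]

theorem RegularScore.exists_abs_score_le (h : RegularScore R) :
    ∃ M : ℝ, 0 ≤ M ∧ ∀ x : E → ℝ, 0 ≤ x → |score R x| ≤ M * ∑ e, x e := by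
  obtain ⟨M, hM⟩ := (isCompact_univ (X := ProbVec E)).exists_bound_of_continuousOn
    h.continuous.continuousOn
  have h0 := (norm_nonneg _).trans (hM (Classical.arbitrary _) trivial)
  refine ⟨M, h0, fun x hx => ?_⟩
  have hs : 0 ≤ ∑ e, x e := Finset.sum_nonneg fun e _ => hx e
  rw [score, sum_mul_eq_expScore hx, abs_mul, abs_of_nonneg hs, mul_comm]
  exact mul_le_mul_of_nonneg_right (hM _ trivial) hs

theorem RegularScore.continuousOn_score (h : RegularScore R) :
    ContinuousOn (score R) {x : E → ℝ | 0 ≤ x} := by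
  intro x hx
  have hsum : Tendsto (fun y : E → ℝ => ∑ e, y e) (𝓝[{y | 0 ≤ y}] x) (𝓝 (∑ e, x e)) :=
    ((by fun_prop : Continuous fun y : E → ℝ => ∑ e, y e).tendsto x).mono_left nhdsWithin_le_nhds
  rcases (Finset.sum_nonneg fun e _ => hx e : 0 ≤ ∑ e, x e).eq_or_lt with h0 | h0
  · obtain ⟨M, hM0, hM⟩ := h.exists_abs_score_le
    have hx0 : score R x = 0 := by
      have := hM x hx
      rw [← h0, mul_zero] at this
      exact abs_eq_zero.1 (le_antisymm this (abs_nonneg _))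
    rw [ContinuousWithinAt, hx0]
    refine squeeze_zero_norm' (a := fun y => M * ∑ e, y e) ?_ ?_
    · filter_upwards [self_mem_nhdsWithin] with y hy using hM y hy
    · simpa [← h0] using hsum.const_mul M
  · have h1 : Tendsto (fun y => (∑ e, y e) * expScore R (normalizeVec y) (normalizeVec y))
        (𝓝[{y | 0 ≤ y}] x) (𝓝 ((∑ e, x e) * expScore R (normalizeVec x) (normalizeVec x))) :=
      hsum.mul ((h.continuous.tendsto _).comp (tendsto_normalizeVec hx h0))
    rw [ContinuousWithinAt, score, sum_mul_eq_expScore hx]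
    refine h1.congr' ?_
    filter_upwards [self_mem_nhdsWithin] with y hy
    rw [score, sum_mul_eq_expScore hy]

theorem RegularScore.tendsto_normalizeVec_apply (h : RegularScore R) {x : E → ℝ} (hx : 0 ≤ x)
    {e : E} (he : 0 < x e) :
    Tendsto (fun y => R (normalizeVec y) e) (𝓝[{y | 0 ≤ y}] x) (𝓝 (R (normalizeVec x) e)) := by
  have hs : 0 < ∑ j, x j := he.trans_le (Finset.single_le_sum (fun j _ => hx j) (Finset.mem_univ e))
  refine (h.tendsto _ e ?_).comp (tendsto_normalizeVec hx hs)
  rw [normalizeVec_apply hx hs]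
  exact div_pos he hs

end Score

/-! ### Supporting prices of a homogeneous function -/

/-- Convex duality. If no way of splitting the all-ones vector makes the sum of the values of a
positively homogeneous `F` smaller than `V`, then some linear functional below `F` takes a value at
least `V` at the all-ones vector. It separates the point `(1, V)` from the convex hull of the
epigraph of `F`. -/
theorem exists_supporting_price {A : Type*} [Fintype A] {F : (A → ℝ) → ℝ} {M V : ℝ}
    (hsmul : ∀ (c : ℝ) (x : A → ℝ), 0 ≤ c → 0 ≤ x → F (c • x) = c * F x)
    (hM : ∀ x : A → ℝ, 0 ≤ x → |F x| ≤ M * ∑ a, x a)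
    (hV : ∀ (n : ℕ) (x : Fin n → A → ℝ), (∀ i, 0 ≤ x i) → ∑ i, x i = 1 → V ≤ ∑ i, F (x i)) :
    ∃ l : A → ℝ, (∀ x, 0 ≤ x → ∑ a, l a * x a ≤ F x) ∧ V ≤ ∑ a, l a := by
  classical
  set T : Set ((A → ℝ) × ℝ) := {z | 0 ≤ z.1 ∧ F z.1 ≤ z.2} with hT
  have hF0 : F 0 = 0 := by simpa using hsmul 0 0 le_rfl le_rfl
  have hTsub : T ⊆ convexHull ℝ T := subset_convexHull ℝ T
  have hnot : ((1 : A → ℝ), V) ∉ interior (convexHull ℝ T) := by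
    intro hmem
    -- a point strictly below `(1, V)` would be a cheaper splitting of the all-ones vector
    have hcont : Continuous fun r : ℝ => ((1 : A → ℝ), r) := by fun_prop
    have hev : ∀ᶠ r in 𝓝 V, ((1 : A → ℝ), r) ∈ convexHull ℝ T :=
      (hcont.tendsto V).eventually (mem_interior_iff_mem_nhds.1 hmem)
    obtain ⟨r, hr, hrV⟩ := ((hev.filter_mono nhdsWithin_le_nhds).and
      (self_mem_nhdsWithin : Set.Iio V ∈ 𝓝[<] V)).exists
    obtain ⟨ι, t, w, z, hw, hw1, hz, hc⟩ := (convexHull_eq T).subset hr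
    rw [Finset.centerMass_eq_of_sum_1 _ _ hw1] at hc
    have e1 : ∑ i ∈ t, w i • (z i).1 = 1 := by
      simpa [Prod.fst_sum] using congrArg Prod.fst hc
    have e2 : ∑ i ∈ t, w i * (z i).2 = r := by
      simpa [Prod.snd_sum] using congrArg Prod.snd hc
    let φ := t.equivFin
    have h := hV t.card (fun k => w (φ.symm k) • (z (φ.symm k)).1)
      (fun k => smul_nonneg (hw _ (φ.symm k).2) (hz _ (φ.symm k).2).1) (by
        rw [Equiv.sum_comp φ.symm (fun i : t => w i • (z i).1), ← e1]
        exact Finset.sum_coe_sort t fun i => w i • (z i).1)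
    rw [Equiv.sum_comp φ.symm (fun i : t => F (w i • (z i).1)),
      Finset.sum_coe_sort t fun i => F (w i • (z i).1)] at h
    have h2 : ∑ i ∈ t, F (w i • (z i).1) ≤ ∑ i ∈ t, w i * (z i).2 :=
      Finset.sum_le_sum fun i hi => by
        rw [hsmul _ _ (hw i hi) (hz i hi).1]
        exact mul_le_mul_of_nonneg_left (hz i hi).2 (hw i hi)
    exact absurd (h.trans (h2.trans_eq e2)) (not_le.2 hrV)
  have hint : (interior (convexHull ℝ T)).Nonempty := by
    refine ⟨(1, M * (∑ a : A, (1 : A → ℝ) a) + 1), mem_interior.2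
      ⟨{z | (∀ a, 0 < z.1 a) ∧ M * ∑ a, z.1 a < z.2}, ?_, ?_, ?_⟩⟩
    · intro z hz
      have h0 : 0 ≤ z.1 := fun a => (hz.1 a).le
      exact hTsub ⟨h0, (le_abs_self _).trans ((hM _ h0).trans hz.2.le)⟩
    · simp only [Set.ofPred_and, Set.ofPred_forall]
      refine IsOpen.inter (isOpen_iInter_of_finite fun a => isOpen_lt (by fun_prop) (by fun_prop))
        (isOpen_lt (by fun_prop) (by fun_prop))
    · exact ⟨fun a => one_pos, lt_add_one _⟩
  obtain ⟨f, hf0, hf⟩ :=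
    geometric_hahn_banach_of_nonempty_interior_point (convex_convexHull ℝ T) hnot hint
  -- `T` is a cone, on which a functional that is bounded above is nonpositive
  have hcone : ∀ z ∈ T, f z ≤ 0 := by
    intro z hz
    by_contra hpos
    push Not at hpos
    obtain ⟨n, hn⟩ := exists_nat_gt (f (1, V) / f z)
    have hn' : ((n : ℝ) • z) ∈ T := by
      refine ⟨smul_nonneg n.cast_nonneg hz.1, ?_⟩
      change F ((n : ℝ) • z.1) ≤ (n : ℝ) * z.2
      rw [hsmul _ _ n.cast_nonneg hz.1]
      exact mul_le_mul_of_nonneg_left hz.2 n.cast_nonneg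
    have h := hf _ (hTsub hn')
    rw [map_smul, smul_eq_mul] at h
    rw [div_lt_iff₀ hpos] at hn
    linarith
  have hfV : 0 ≤ f (1, V) := by
    have h0 : (0 : (A → ℝ) × ℝ) ∈ T := ⟨le_rfl, hF0.le⟩
    simpa using hf _ (hTsub h0)
  set g : A → ℝ := fun a => f (Pi.single a 1, 0) with hg
  set c : ℝ := f (0, 1) with hcdef
  have hfx : ∀ (x : A → ℝ) (r : ℝ), f (x, r) = ∑ a, g a * x a + c * r := by
    intro x r
    have hx : ((x, r) : (A → ℝ) × ℝ) = ∑ a, x a • ((Pi.single a 1 : A → ℝ), (0 : ℝ))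
        + r • ((0 : A → ℝ), (1 : ℝ)) := by
      refine Prod.ext ?_ ?_
      · ext b
        simp [Prod.fst_sum, Finset.sum_apply, Pi.single_apply]
      · simp [Prod.snd_sum]
    rw [hx, map_add, map_sum, map_smul]
    simp only [map_smul, smul_eq_mul, hg, hcdef, mul_comm]
  have hc0 : c ≤ 0 := by
    have h := hcone (0, 1) ⟨le_rfl, by simp [hF0]⟩
    exact h
  -- the separating hyperplane is not vertical because the all-ones vector is an interior point
  have hc : c < 0 := by
    refine hc0.lt_of_ne fun hc => hf0 ?_
    have hg0 : ∀ a, g a ≤ 0 := by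
      intro a
      have hs : (0 : A → ℝ) ≤ Pi.single a 1 := Pi.single_nonneg.2 zero_le_one
      have h := hcone (Pi.single a 1, F (Pi.single a 1)) ⟨hs, le_rfl⟩
      rw [hfx, hc] at h
      simpa [Pi.single_apply] using h
    have hsum : ∑ a, g a = 0 := by
      refine le_antisymm (Finset.sum_nonpos fun a _ => hg0 a) ?_
      rw [hfx, hc] at hfV
      simpa using hfV
    have hgz := (Finset.sum_eq_zero_iff_of_nonpos fun a _ => hg0 a).1 hsum
    refine ContinuousLinearMap.ext fun z => ?_
    rw [show z = (z.1, z.2) from rfl, hfx, hc, zero_mul, add_zero]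
    exact Finset.sum_eq_zero fun a ha => by rw [hgz a ha, zero_mul]
  refine ⟨fun a => g a / (-c), fun x hx => ?_, ?_⟩
  · have h := hcone (x, F x) ⟨hx, le_rfl⟩
    rw [hfx] at h
    have : ∑ a, g a / (-c) * x a = (∑ a, g a * x a) / (-c) := by
      rw [Finset.sum_div]; exact Finset.sum_congr rfl fun a _ => by ring
    rw [this, div_le_iff₀ (by linarith)]
    linarith
  · rw [hfx] at hfV
    simp only [Pi.one_apply, mul_one] at hfV
    rw [← Finset.sum_div, le_div_iff₀ (by linarith)]
    linarith

/-! ### Minimization with a logarithmic barrier -/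

/-- On a compact set of vectors with coordinates in `[0, 1]` that contains a strictly positive
vector, a continuous function with a logarithmic barrier has a strictly positive minimizer. -/
theorem exists_barrier_minimizer {ι : Type*} [Fintype ι] {K : Set (ι → ℝ)} (hK : IsCompact K)
    (hK1 : ∀ z ∈ K, ∀ i, z i ≤ 1) {f : (ι → ℝ) → ℝ} (hf : ContinuousOn f K) {c : ℝ} (hc : 0 < c)
    {r : ι → ℝ} (hr : r ∈ K) (hr0 : ∀ i, 0 < r i) :
    ∃ z ∈ K, (∀ i, 0 < z i) ∧ ∀ y ∈ K, (∀ i, 0 < y i) →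
      f z - c * ∑ i, Real.log (z i) ≤ f y - c * ∑ i, Real.log (y i) := by
  obtain ⟨m, hm, hmin⟩ := hK.exists_isMinOn ⟨r, hr⟩ hf
  set L := f r - c * ∑ i, Real.log (r i) with hL
  set δ := Real.exp (-((L - f m) / c)) with hδ
  -- a coordinate below `δ` makes the barrier exceed the value at the reference point
  have hlow : ∀ y ∈ K, (∀ i, 0 < y i) → f y - c * ∑ i, Real.log (y i) ≤ L → ∀ i, δ ≤ y i := by
    intro y hy hy0 hyL i
    rw [hδ, ← Real.le_log_iff_exp_le (hy0 i)]
    have h1 : ∑ j, Real.log (y j) ≤ Real.log (y i) := by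
      have h2 : ∑ j, -Real.log (y j) ≥ -Real.log (y i) :=
        Finset.single_le_sum (f := fun j => -Real.log (y j)) (fun j _ => by
          simpa using Real.log_nonpos (hy0 j).le (hK1 y hy j)) (Finset.mem_univ i)
      rw [Finset.sum_neg_distrib] at h2
      linarith
    have h3 : f m ≤ f y := hmin hy
    have h4 : c * ∑ j, Real.log (y j) ≤ c * Real.log (y i) := mul_le_mul_of_nonneg_left h1 hc.le
    rw [← neg_div, div_le_iff₀ hc]
    linarith
  have hδ0 : 0 < δ := Real.exp_pos _
  set K' := K ∩ {y | ∀ i, δ ≤ y i} with hK'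
  have hK'c : IsCompact K' := by
    refine hK.inter_right ?_
    simp only [Set.ofPred_forall]
    exact isClosed_iInter fun i => isClosed_le continuous_const (continuous_apply i)
  have hcont : ContinuousOn (fun y : ι → ℝ => f y - c * ∑ i, Real.log (y i)) K' := by
    refine (hf.mono Set.inter_subset_left).sub (continuousOn_const.mul ?_)
    refine continuousOn_finsetSum _ fun i _ => ?_
    exact (continuous_apply i).continuousOn.log fun y hy => (hδ0.trans_le (hy.2 i)).ne'
  have hrK' : r ∈ K' := ⟨hr, hlow r hr hr0 le_rfl⟩
  obtain ⟨z, hz, hzmin⟩ := hK'c.exists_isMinOn ⟨r, hrK'⟩ hcont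
  refine ⟨z, hz.1, fun i => hδ0.trans_le (hz.2 i), fun y hy hy0 => ?_⟩
  rcases le_total (f y - c * ∑ i, Real.log (y i)) L with h | h
  · exact hzmin ⟨hy, hlow y hy hy0 h⟩
  · exact (hzmin hrK').trans h

/-! ### Bob's gain from a signal, as a function of its likelihood vector -/

section Gain

variable {E A B : Type*} [Fintype E] [Fintype A] [Fintype B]

/-- `Pr[S = s, B = b, E = e]` when `l a = Pr[S = s | A = a]`. -/
def jointB (μ : ProbVec (E × A × B)) (l : A → ℝ) (b : B) (e : E) : ℝ := ∑ a, l a * μ (e, a, b)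

/-- `Pr[S = s, E = e]` when `l a = Pr[S = s | A = a]`. -/
def jointE (μ : ProbVec (E × A × B)) (l : A → ℝ) (e : E) : ℝ := ∑ b, jointB μ l b e

variable {μ : ProbVec (E × A × B)}

theorem jointB_nonneg {l : A → ℝ} (hl : 0 ≤ l) (b : B) : 0 ≤ jointB μ l b := fun _ =>
  Finset.sum_nonneg fun a _ => mul_nonneg (hl a) (μ.2.1 _)

theorem jointE_nonneg {l : A → ℝ} (hl : 0 ≤ l) : 0 ≤ jointE μ l := fun _ =>
  Finset.sum_nonneg fun b _ => jointB_nonneg hl b _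

theorem sum_jointE (l : A → ℝ) : ∑ e, jointE μ l e = ∑ a, l a * probA μ a := by
  simp only [jointE, jointB, probA, Finset.mul_sum]
  rw [Finset.sum_comm' (t' := Finset.univ) (s' := fun _ => Finset.univ) (by simp)]
  simp_rw [Finset.sum_comm (s := (Finset.univ : Finset E)) (t := (Finset.univ : Finset A))]
  rw [Finset.sum_comm]
  exact Finset.sum_congr rfl fun a _ => Finset.sum_comm

theorem probA_nonneg (μ : ProbVec (E × A × B)) (a : A) : 0 ≤ probA μ a :=
  Finset.sum_nonneg fun _ _ => Finset.sum_nonneg fun _ _ => μ.2.1 _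

theorem probAB_nonneg (μ : ProbVec (E × A × B)) (a : A) (b : B) : 0 ≤ probAB μ a b :=
  Finset.sum_nonneg fun _ _ => μ.2.1 _

theorem sum_prior (μ : ProbVec (E × A × B)) : ∑ e, ∑ a, ∑ b, μ (e, a, b) = 1 := by
  have h := μ.2.2
  rw [Fintype.sum_prod_type] at h
  simp only [Fintype.sum_prod_type] at h
  exact h

theorem sum_probA (μ : ProbVec (E × A × B)) : ∑ a, probA μ a = 1 := by
  rw [← sum_prior μ]
  simp only [probA]
  exact Finset.sum_comm

theorem probA_le_one (μ : ProbVec (E × A × B)) (a : A) : probA μ a ≤ 1 := by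
  rw [← sum_probA μ]
  exact Finset.single_le_sum (fun a _ => probA_nonneg μ a) (Finset.mem_univ a)

theorem prior_eq_zero_of_probA {a : A} (h : probA μ a = 0) (e : E) (b : B) : μ (e, a, b) = 0 := by
  have h1 := (Finset.sum_eq_zero_iff_of_nonneg fun e _ =>
    Finset.sum_nonneg fun b _ => μ.2.1 (e, a, b)).1 h e (Finset.mem_univ e)
  exact (Finset.sum_eq_zero_iff_of_nonneg fun b _ => μ.2.1 (e, a, b)).1 h1 b (Finset.mem_univ b)

theorem prior_eq_zero_of_probAB {a : A} {b : B} (h : probAB μ a b = 0) (e : E) :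
    μ (e, a, b) = 0 :=
  (Finset.sum_eq_zero_iff_of_nonneg fun e _ => μ.2.1 (e, a, b)).1 h e (Finset.mem_univ e)

theorem jointB_add (x y : A → ℝ) (b : B) : jointB μ (x + y) b = jointB μ x b + jointB μ y b := by
  ext e
  simp [jointB, add_mul, Finset.sum_add_distrib]

theorem jointB_smul (c : ℝ) (x : A → ℝ) (b : B) :
    jointB μ (c • x) b = fun e => c * jointB μ x b e := by
  ext e
  simp [jointB, mul_assoc, Finset.mul_sum]

theorem jointE_add (x y : A → ℝ) : jointE μ (x + y) = jointE μ x + jointE μ y := by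
  ext e
  simp [jointE, jointB_add, Finset.sum_add_distrib]

theorem jointE_smul (c : ℝ) (x : A → ℝ) : jointE μ (c • x) = fun e => c * jointE μ x e := by
  ext e
  simp [jointE, jointB_smul, Finset.mul_sum]

theorem jointE_sum {ι : Type*} (s : Finset ι) (x : ι → A → ℝ) (e : E) :
    jointE μ (∑ i ∈ s, x i) e = ∑ i ∈ s, jointE μ (x i) e := by
  classical
  induction s using Finset.induction_on with
  | empty => simp [jointE, jointB]
  | insert i s hi ih =>
    rw [Finset.sum_insert hi, Finset.sum_insert hi, jointE_add, Pi.add_apply, ih]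

theorem continuous_jointB (b : B) : Continuous fun l : A → ℝ => jointB μ l b :=
  continuous_pi fun e => by unfold jointB; fun_prop

theorem continuous_jointE : Continuous fun l : A → ℝ => jointE μ l :=
  continuous_pi fun e => continuous_finsetSum _ fun b _ =>
    (continuous_apply e).comp (continuous_jointB b)

variable [Nonempty E]

/-- The posterior on the event given a signal with likelihood vector `l`. -/
def post (μ : ProbVec (E × A × B)) (l : A → ℝ) : ProbVec E := normalizeVec (jointE μ l)

/-- The posterior on the event given a signal with likelihood vector `l` and Bob's signal `b`. -/
def postB (μ : ProbVec (E × A × B)) (l : A → ℝ) (b : B) : ProbVec E := normalizeVec (jointB μ l b)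

/-- What type `a` of Alice loses to Bob, weighted with `Pr[A = a]`, when she reports `p` and Bob
then reports the posterior that the likelihood vector `l` induces. -/
def devCost (μ : ProbVec (E × A × B)) (R : ProbVec E → E → ℝ) (l : A → ℝ) (p : ProbVec E)
    (a : A) : ℝ := ∑ b, ∑ e, μ (e, a, b) * (R (postB μ l b) e - R p e)

/-- Bob's expected gain from a signal with likelihood vector `l` that Alice sends truthfully. -/
def bobGain (μ : ProbVec (E × A × B)) (R : ProbVec E → E → ℝ) (l : A → ℝ) : ℝ :=
  ∑ b, score R (jointB μ l b) - score R (jointE μ l)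

variable {R : ProbVec E → E → ℝ}

theorem sum_mul_devCost (d l : A → ℝ) (p : ProbVec E) :
    ∑ a, d a * devCost μ R l p a =
      ∑ b, ∑ e, jointB μ d b e * R (postB μ l b) e - ∑ e, jointE μ d e * R p e := by
  have h1 : ∑ a, d a * devCost μ R l p a =
      ∑ b, ∑ e, jointB μ d b e * (R (postB μ l b) e - R p e) := by
    simp only [devCost, jointB, Finset.mul_sum, Finset.sum_mul]
    rw [Finset.sum_comm]
    refine Finset.sum_congr rfl fun b _ => ?_
    rw [Finset.sum_comm]
    exact Finset.sum_congr rfl fun e _ => Finset.sum_congr rfl fun a _ => by ring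
  rw [h1]
  simp only [mul_sub, Finset.sum_sub_distrib, jointE, Finset.sum_mul]
  congr 1
  exact Finset.sum_comm

theorem sum_mul_devCost_self (l : A → ℝ) (p : ProbVec E) :
    ∑ a, l a * devCost μ R l p a =
      ∑ b, score R (jointB μ l b) - ∑ e, jointE μ l e * R p e := by
  rw [sum_mul_devCost]
  rfl

theorem bobGain_eq_sum_mul_devCost (l : A → ℝ) :
    bobGain μ R l = ∑ a, l a * devCost μ R l (post μ l) a := by
  rw [sum_mul_devCost_self]
  rfl

/-- The truthful report is the one that leaves Bob the smallest gain. -/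
theorem RegularScore.bobGain_le_sum_mul_devCost (hR : RegularScore R) {l : A → ℝ} (hl : 0 ≤ l)
    (p : ProbVec E) :
    bobGain μ R l ≤ ∑ a, l a * devCost μ R l p a := by
  rw [sum_mul_devCost_self]
  exact sub_le_sub_left (hR.sum_mul_le_score (jointE_nonneg hl) p) _

/-- Bob gains most if his inference agrees with the signal actually sent. -/
theorem RegularScore.sum_mul_devCost_le (hR : RegularScore R) {x y : A → ℝ} (hx : 0 ≤ x)
    (p : ProbVec E) :
    ∑ a, x a * devCost μ R y p a ≤ ∑ a, x a * devCost μ R x p a := by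
  rw [sum_mul_devCost_self, sum_mul_devCost]
  exact sub_le_sub_right (Finset.sum_le_sum fun b _ =>
    hR.sum_mul_le_score (jointB_nonneg hx b) _) _

/-- `bobGain` is a difference of two convex functions, the expected score of Bob's report and that
of Alice's report. The tangent of the first one at the end point `y` and that of the second one at
the starting point `x` bound the increment of `bobGain`. -/
theorem RegularScore.bobGain_sub_le (hR : RegularScore R) {x y : A → ℝ} (hx : 0 ≤ x) (hy : 0 ≤ y) :
    bobGain μ R y - bobGain μ R x ≤ ∑ a, (y a - x a) * devCost μ R y (post μ x) a := by
  have h1 := hR.bobGain_le_sum_mul_devCost (μ := μ) hy (post μ x)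
  have h2 := hR.sum_mul_devCost_le (μ := μ) (y := y) hx (post μ x)
  rw [← bobGain_eq_sum_mul_devCost] at h2
  simp only [sub_mul, Finset.sum_sub_distrib]
  linarith

theorem RegularScore.tendsto_devCost (hR : RegularScore R) {x : A → ℝ} (hx : 0 ≤ x) {a : A}
    (ha : 0 < x a) (p : ProbVec E) : Tendsto (fun y => devCost μ R y p a) (𝓝[{y | 0 ≤ y}] x)
      (𝓝 (devCost μ R x p a)) := by
  refine tendsto_finsetSum _ fun b _ => tendsto_finsetSum _ fun e _ => ?_
  rcases (μ.2.1 (e, a, b)).eq_or_lt with h | h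
  · have h' : μ (e, a, b) = 0 := h.symm
    simpa [h'] using tendsto_const_nhds
  · refine (Tendsto.sub_const ?_ _).const_mul _
    have hpos : 0 < jointB μ x b e := (mul_pos ha h).trans_le
      (Finset.single_le_sum (f := fun a => x a * μ (e, a, b))
        (fun a _ => mul_nonneg (hx a) (μ.2.1 _)) (Finset.mem_univ a))
    refine (hR.tendsto_normalizeVec_apply (jointB_nonneg hx b) hpos).comp ?_
    refine tendsto_nhdsWithin_iff.2 ⟨((continuous_jointB b).tendsto x).mono_left
      nhdsWithin_le_nhds, ?_⟩
    filter_upwards [self_mem_nhdsWithin] with y hy using jointB_nonneg hy b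

theorem RegularScore.tendsto_devCost_post (hR : RegularScore R) {x : A → ℝ} (hx : 0 ≤ x) {a : A}
    (ha : 0 < x a) :
    Tendsto (fun y => devCost μ R y (post μ y) a) (𝓝[{y | 0 ≤ y}] x)
      (𝓝 (devCost μ R x (post μ x) a)) := by
  have key : ∀ l p, devCost μ R l p a = devCost μ R l (post μ x) a
      + ∑ b, ∑ e, μ (e, a, b) * (R (post μ x) e - R p e) := by
    intro l p
    simp only [devCost, ← Finset.sum_add_distrib]
    exact Finset.sum_congr rfl fun b _ => Finset.sum_congr rfl fun e _ => by ring
  rw [key x (post μ x)]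
  refine Tendsto.congr (fun y => (key y (post μ y)).symm) ?_
  refine (hR.tendsto_devCost hx ha _).add ?_
  refine tendsto_finsetSum _ fun b _ => tendsto_finsetSum _ fun e _ => ?_
  rcases (μ.2.1 (e, a, b)).eq_or_lt with h | h
  · have h' : μ (e, a, b) = 0 := h.symm
    simpa [h'] using tendsto_const_nhds
  · refine (Tendsto.const_sub _ ?_).const_mul _
    have hpos : 0 < jointE μ x e := ((mul_pos ha h).trans_le
      (Finset.single_le_sum (f := fun a => x a * μ (e, a, b))
        (fun a _ => mul_nonneg (hx a) (μ.2.1 _)) (Finset.mem_univ a))).trans_le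
      (Finset.single_le_sum (f := fun b => jointB μ x b e)
        (fun b _ => jointB_nonneg hx b e) (Finset.mem_univ b))
    refine (hR.tendsto_normalizeVec_apply (jointE_nonneg hx) hpos).comp ?_
    refine tendsto_nhdsWithin_iff.2 ⟨(continuous_jointE.tendsto x).mono_left
      nhdsWithin_le_nhds, ?_⟩
    filter_upwards [self_mem_nhdsWithin] with y hy using jointE_nonneg hy

theorem RegularScore.continuousOn_bobGain (hR : RegularScore R) :
    ContinuousOn (bobGain μ R) {l | 0 ≤ l} := by
  refine ContinuousOn.sub (continuousOn_finsetSum _ fun b _ => ?_) ?_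
  · exact hR.continuousOn_score.comp (continuous_jointB b).continuousOn
      fun l hl => jointB_nonneg hl b
  · exact hR.continuousOn_score.comp continuous_jointE.continuousOn fun l hl => jointE_nonneg hl

theorem RegularScore.continuousOn_sum_mul_devCost (hR : RegularScore R) (p : ProbVec E) :
    ContinuousOn (fun l => ∑ a, l a * devCost μ R l p a) {l | 0 ≤ l} := by
  simp only [sum_mul_devCost_self]
  refine ContinuousOn.sub (continuousOn_finsetSum _ fun b _ => ?_) ?_
  · exact hR.continuousOn_score.comp (continuous_jointB b).continuousOn
      fun l hl => jointB_nonneg hl b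
  · refine Continuous.continuousOn (continuous_finsetSum _ fun e _ => ?_)
    exact ((continuous_apply e).comp continuous_jointE).mul continuous_const

theorem RegularScore.exists_abs_bobGain_le (hR : RegularScore R) :
    ∃ M : ℝ, ∀ l : A → ℝ, 0 ≤ l → |bobGain μ R l| ≤ M * ∑ a, l a := by
  obtain ⟨M, hM0, hM⟩ := hR.exists_abs_score_le
  refine ⟨2 * M, fun l hl => ?_⟩
  have h1 : ∑ e, jointE μ l e ≤ ∑ a, l a := by
    rw [sum_jointE]
    exact Finset.sum_le_sum fun a _ => mul_le_of_le_one_right (hl a) (probA_le_one μ a)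
  have h2 : |∑ b, score R (jointB μ l b)| ≤ M * ∑ e, jointE μ l e := by
    refine (Finset.abs_sum_le_sum_abs _ _).trans ?_
    simp only [jointE]
    rw [Finset.sum_comm, Finset.mul_sum]
    exact Finset.sum_le_sum fun b _ => hM _ (jointB_nonneg hl b)
  have h3 := hM _ (jointE_nonneg (μ := μ) hl)
  have h4 := abs_sub (∑ b, score R (jointB μ l b)) (score R (jointE μ l))
  have h5 := mul_le_mul_of_nonneg_left h1 hM0
  rw [bobGain]
  linarith

theorem bobGain_smul {c : ℝ} (hc : 0 ≤ c) (l : A → ℝ) :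
    bobGain μ R (c • l) = c * bobGain μ R l := by
  simp only [bobGain, jointB_smul, jointE_smul, score_smul hc, mul_sub, Finset.mul_sum]

end Gain

section Prices

variable {E A B : Type*} [Fintype E] [Fintype A] [Fintype B] [Nonempty E]
variable {μ : ProbVec (E × A × B)} {R : ProbVec E → E → ℝ}

theorem RegularScore.tendsto_devCost_path (hR : RegularScore R) {x : A → ℝ} (hx : 0 ≤ x) {a : A}
    (ha : 0 < x a) (p : ProbVec E) {y : ℝ → A → ℝ} (hy : Continuous y) (hy0 : y 0 = x)
    (hpos : ∀ t ∈ Set.Ioo (0 : ℝ) 1, 0 ≤ y t) :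
    Tendsto (fun t => devCost μ R (y t) p a) (𝓝[>] 0) (𝓝 (devCost μ R x p a)) := by
  refine (hR.tendsto_devCost hx ha p).comp (tendsto_nhdsWithin_iff.2 ⟨?_, ?_⟩)
  · rw [← hy0]
    exact (hy.tendsto 0).mono_left nhdsWithin_le_nhds
  · filter_upwards [Ioo_mem_nhdsGT one_pos] with t ht using hpos t ht

/-! ### Off-path inferences that deter every type of Alice -/

theorem neg_log_one_sub_le {t : ℝ} (ht : t < 1) : -Real.log (1 - t) ≤ t / (1 - t) := by
  have h := Real.one_sub_inv_le_log_of_pos (sub_pos.2 ht)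
  have : t / (1 - t) = (1 - t)⁻¹ - 1 := by
    field_simp [(sub_pos.2 ht).ne']
    ring
  linarith

/-- After any report `p` there is a full-support inference of Bob under which no type of Alice does
better than to lose her price `l a` to Bob, up to `ε`. It minimizes, with a logarithmic barrier, the
convex function `x ↦ ∑ a, x a * devCost μ R x p a - ∑ a, l a * x a` on the simplex; this function is
nonnegative, homogeneous, and has the gradient `devCost μ R x p - l`. -/
theorem RegularScore.exists_deterring_likelihood (hR : RegularScore R) {l : A → ℝ}
    (hl : ∀ x : A → ℝ, 0 ≤ x → ∑ a, l a * x a ≤ bobGain μ R x) (p : ProbVec E) {ε : ℝ}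
    (hε : 0 < ε) : ∃ x : A → ℝ, (∀ a, 0 < x a) ∧ ∀ a, l a - ε ≤ devCost μ R x p a := by
  classical
  rcases isEmpty_or_nonempty A with hA | hA
  · exact ⟨isEmptyElim, isEmptyElim, isEmptyElim⟩
  set n : ℝ := ((Fintype.card A : ℕ) : ℝ) with hn
  have hn0 : 0 < n := Nat.cast_pos.2 Fintype.card_pos
  have hc : 0 < ε / n := div_pos hε hn0
  obtain ⟨x, hx, hx0, hmin⟩ := exists_barrier_minimizer (isCompact_stdSimplex ℝ A)
    (fun z hz i => (mem_Icc_of_mem_stdSimplex hz i).2)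
    (f := fun x => ∑ a, x a * devCost μ R x p a - ∑ a, l a * x a)
    (((hR.continuousOn_sum_mul_devCost p).mono fun z hz => hz.1).sub
      (by fun_prop : Continuous fun x : A → ℝ => ∑ a, l a * x a).continuousOn) hc
    (r := fun _ => n⁻¹) ⟨fun _ => (inv_pos.2 hn0).le, by simp [← hn, hn0.ne']⟩
    (fun _ => inv_pos.2 hn0)
  have hxn : 0 ≤ x := hx.1
  refine ⟨x, hx0, fun a => ?_⟩
  set y : ℝ → A → ℝ := fun t a' => (1 - t) * x a' + t * (if a' = a then 1 else 0) with hy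
  have hyc : Continuous y := by
    refine continuous_pi fun a' => ?_
    simp only [hy]
    fun_prop
  have hy0 : y 0 = x := by ext a'; simp [hy]
  have hylow : ∀ t ∈ Set.Ioo (0 : ℝ) 1, ∀ a', (1 - t) * x a' ≤ y t a' := by
    intro t ht a'
    simp only [hy]
    have : 0 ≤ t * (if a' = a then (1 : ℝ) else 0) := mul_nonneg ht.1.le (by split_ifs <;> simp)
    linarith
  have hypos : ∀ t ∈ Set.Ioo (0 : ℝ) 1, ∀ a', 0 < y t a' := fun t ht a' =>
    (mul_pos (sub_pos.2 ht.2) (hx0 a')).trans_le (hylow t ht a')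
  have hymem : ∀ t ∈ Set.Ioo (0 : ℝ) 1, y t ∈ stdSimplex ℝ A := fun t ht =>
    ⟨fun a' => (hypos t ht a').le, by
      simp only [hy, Finset.sum_add_distrib, ← Finset.mul_sum, hx.2]; simp⟩
  have hdiff : ∀ (t : ℝ) (g : A → ℝ),
      ∑ a', (y t a' - x a') * g a' = t * (g a - ∑ a', x a' * g a') := by
    intro t g
    have : ∀ a', (y t a' - x a') * g a' = t * ((if a' = a then g a' else 0) - x a' * g a') := by
      intro a'
      simp only [hy]
      split_ifs <;> ring
    simp only [this, ← Finset.mul_sum, Finset.sum_sub_distrib]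
    simp
  -- minimality along the path, divided by `t`; `n * (ε / n)` is the effect of the barrier
  have hineq : ∀ t ∈ Set.Ioo (0 : ℝ) 1, 0 ≤ devCost μ R (y t) p a
      - ∑ a', x a' * devCost μ R (y t) p a' - l a + ∑ a', l a' * x a' + ε / (1 - t) := by
    intro t ht
    have h1 := hmin (y t) (hymem t ht) (hypos t ht)
    have h2 := hR.sum_mul_devCost_le (μ := μ) (y := y t) hxn p
    have h3 := hdiff t (devCost μ R (y t) p)
    have h4 := hdiff t l
    have h5 : ∑ a', Real.log (x a') + n * Real.log (1 - t) ≤ ∑ a', Real.log (y t a') := by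
      have : n * Real.log (1 - t) = ∑ _a' : A, Real.log (1 - t) := by simp [hn]
      rw [this, ← Finset.sum_add_distrib]
      refine Finset.sum_le_sum fun a' _ => ?_
      rw [add_comm, ← Real.log_mul (sub_pos.2 ht.2).ne' (hx0 a').ne']
      exact Real.log_le_log (mul_pos (sub_pos.2 ht.2) (hx0 a')) (hylow t ht a')
    have h6 := neg_log_one_sub_le ht.2
    have h7 : ε / n * (∑ a', Real.log (x a') - ∑ a', Real.log (y t a')) ≤ ε * (t / (1 - t)) := by
      have : ε / n * (∑ a', Real.log (x a') - ∑ a', Real.log (y t a'))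
          ≤ ε / n * (n * (t / (1 - t))) := by
        refine mul_le_mul_of_nonneg_left ?_ hc.le
        have := mul_le_mul_of_nonneg_left h6 hn0.le
        linarith
      refine this.trans_eq ?_
      field_simp
    simp only [sub_mul, Finset.sum_sub_distrib] at h3 h4
    have h8 : ∑ a', l a' * y t a' = ∑ a', y t a' * l a' :=
      Finset.sum_congr rfl fun _ _ => mul_comm _ _
    have h9 : ∑ a', l a' * x a' = ∑ a', x a' * l a' :=
      Finset.sum_congr rfl fun _ _ => mul_comm _ _
    have h10 : 0 ≤ t * (devCost μ R (y t) p a - ∑ a', x a' * devCost μ R (y t) p a' - l a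
        + ∑ a', l a' * x a' + ε / (1 - t)) := by
      rw [h8, h9] at h1
      rw [h9]
      have : t * (ε / (1 - t)) = ε * (t / (1 - t)) := by ring
      linarith
    exact nonneg_of_mul_nonneg_right h10 ht.1
  have hlim : Tendsto (fun t => devCost μ R (y t) p a
      - ∑ a', x a' * devCost μ R (y t) p a' - l a + ∑ a', l a' * x a' + ε / (1 - t)) (𝓝[>] 0)
      (𝓝 (devCost μ R x p a - ∑ a', x a' * devCost μ R x p a' - l a + ∑ a', l a' * x a'
        + ε / (1 - 0))) := by
    have hd : ∀ a', Tendsto (fun t => devCost μ R (y t) p a') (𝓝[>] 0)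
        (𝓝 (devCost μ R x p a')) := fun a' =>
      hR.tendsto_devCost_path hxn (hx0 a') p hyc hy0 fun t ht => (hymem t ht).1
    refine ((((hd a).sub (tendsto_finsetSum _ fun a' _ =>
      (hd a').const_mul _)).sub_const _).add_const _).add ?_
    refine Tendsto.mono_left ?_ nhdsWithin_le_nhds
    have : ContinuousAt (fun t : ℝ => ε / (1 - t)) 0 :=
      continuousAt_const.div (by fun_prop) (by norm_num)
    exact this.tendsto
  have h0 := ge_of_tendsto hlim (by
    filter_upwards [Ioo_mem_nhdsGT one_pos] with t ht using hineq t ht)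
  have h1 := (hl x hxn).trans (hR.bobGain_le_sum_mul_devCost hxn p)
  simp only [sub_zero, div_one] at h0
  linarith

/-! ### Perturbing an optimal scheme into a full-support one -/

/-- A type that sends a signal of an optimal scheme pays at least her price: Bob's gain touches its
lower bound `∑ a, l a * x a` at `x`, so it grows at least at the rate `l a` in the direction `a`,
and it cannot grow faster than the cost of type `a`. -/
theorem RegularScore.price_le_devCost_of_tight (hR : RegularScore R) {l : A → ℝ}
    (hl : ∀ x : A → ℝ, 0 ≤ x → ∑ a, l a * x a ≤ bobGain μ R x) {x : A → ℝ} (hx : 0 ≤ x)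
    (htight : bobGain μ R x = ∑ a, l a * x a) {a : A} (ha : 0 < x a) :
    l a ≤ devCost μ R x (post μ x) a := by
  classical
  set y : ℝ → A → ℝ := fun t a' => x a' + t * (if a' = a then 1 else 0) with hy
  have hyc : Continuous y := by
    refine continuous_pi fun a' => ?_
    simp only [hy]
    fun_prop
  have hypos : ∀ t ∈ Set.Ioo (0 : ℝ) 1, 0 ≤ y t := fun t ht a' =>
    add_nonneg (hx a') (mul_nonneg ht.1.le (by split_ifs <;> simp))
  have hlim := hR.tendsto_devCost_path (μ := μ) hx ha (post μ x) hyc (by ext; simp [hy]) hypos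
  refine ge_of_tendsto hlim ?_
  filter_upwards [Ioo_mem_nhdsGT one_pos] with t ht
  have h1 := hl _ (hypos t ht)
  have h2 := hR.bobGain_sub_le (μ := μ) hx (hypos t ht)
  have hd : ∀ g : A → ℝ, ∑ a', (y t a' - x a') * g a' = t * g a := by
    intro g
    have : ∀ a', (y t a' - x a') * g a' = if a' = a then t * g a' else 0 := by
      intro a'
      simp only [hy]
      split_ifs <;> ring
    simp [this]
  have h3 : ∑ a', l a' * y t a' - ∑ a', l a' * x a' = t * l a := by
    rw [← hd l, ← Finset.sum_sub_distrib]
    exact Finset.sum_congr rfl fun _ _ => by ring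
  rw [hd] at h2
  exact le_of_mul_le_mul_left (by linarith) ht.1

end Prices

section Perturbation

variable {E A B : Type*} [Fintype E] [Fintype A] [Fintype B] [Nonempty E]
variable {μ : ProbVec (E × A × B)} {R : ProbVec E → E → ℝ}

/-- The families of likelihood vectors that split the all-ones vector. -/
def splittings (ι A : Type*) [Fintype ι] : Set (ι × A → ℝ) :=
  {z | (∀ k, 0 ≤ z k) ∧ ∀ a, ∑ i, z (i, a) = 1}

theorem le_one_of_mem_splittings {ι : Type*} [Fintype ι] {z : ι × A → ℝ}
    (hz : z ∈ splittings ι A) (k : ι × A) : z k ≤ 1 := by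
  rw [← hz.2 k.2]
  exact Finset.single_le_sum (f := fun i => z (i, k.2)) (fun i _ => hz.1 _) (Finset.mem_univ k.1)

theorem isCompact_splittings {ι : Type*} [Fintype ι] : IsCompact (splittings ι A) := by
  refine (isCompact_Icc (a := (0 : ι × A → ℝ)) (b := 1)).of_isClosed_subset ?_ fun z hz =>
    ⟨hz.1, le_one_of_mem_splittings hz⟩
  simp only [splittings, Set.ofPred_and, Set.ofPred_forall]
  exact (isClosed_iInter fun k => isClosed_le continuous_const (continuous_apply k)).inter
    (isClosed_iInter fun a => isClosed_eq (by fun_prop) continuous_const)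

/-- Near an optimal scheme `x` there is a full-support scheme `z` in which, up to small errors, no
type gains by moving mass from one signal to another. It minimizes Bob's total gain plus a multiple
`η` of the distance to `x`, with a logarithmic barrier. -/
theorem RegularScore.exists_perturbation_exchange (hR : RegularScore R) {l : A → ℝ}
    (hl : ∀ x : A → ℝ, 0 ≤ x → ∑ a, l a * x a ≤ bobGain μ R x)
    {ι : Type*} [Fintype ι] [Nonempty ι] {x : ι → A → ℝ} (hx : ∀ i, 0 ≤ x i)
    (hx1 : ∑ i, x i = 1) (htight : ∀ i, bobGain μ R (x i) = ∑ a, l a * x i a)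
    {η ρ κ : ℝ} (hη : 0 < η) (hρ : 0 < ρ) (hκ : 0 < κ) :
    ∃ z : ι → A → ℝ, (∀ i a, 0 < z i a) ∧ ∑ i, z i = 1 ∧ (∀ i a, |z i a - x i a| ≤ ρ) ∧
      ∀ i j a, 0 ≤ z j a * (devCost μ R (z i) (post μ (z i)) a
        - devCost μ R (z j) (post μ (z j)) a) + 2 * η * z j a + κ := by
  classical
  set row : (ι × A → ℝ) → ι → A → ℝ := fun z i a => z (i, a) with hrow
  have hrowc : ∀ i, Continuous fun z => row z i := fun i =>
    continuous_pi fun a => continuous_apply (i, a)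
  set f : (ι × A → ℝ) → ℝ := fun z =>
    ∑ i, bobGain μ R (row z i) + η * ∑ k, |z k - x k.1 k.2| with hf
  have hfc : ContinuousOn f (splittings ι A) := by
    refine ContinuousOn.add (continuousOn_finsetSum _ fun i _ => ?_) (Continuous.continuousOn ?_)
    · exact hR.continuousOn_bobGain.comp (hrowc i).continuousOn fun z hz a => hz.1 _
    · fun_prop
  have hsum : ∀ z ∈ splittings ι A, ∑ i, ∑ a, l a * row z i a = ∑ a, l a := by
    intro z hz
    rw [Finset.sum_comm]
    refine Finset.sum_congr rfl fun a _ => ?_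
    rw [← Finset.mul_sum, hz.2 a, mul_one]
  have hx1' : ∀ a, ∑ i, x i a = 1 := fun a => by
    have := congrFun hx1 a
    rwa [Finset.sum_apply] at this
  set X : ι × A → ℝ := fun k => x k.1 k.2 with hX
  have hXK : X ∈ splittings ι A := ⟨fun k => hx _ _, hx1'⟩
  have hfX : f X = ∑ a, l a := by
    rw [← hsum X hXK]
    simp only [hf, hX, sub_self, abs_zero, Finset.sum_const_zero, mul_zero, add_zero]
    exact Finset.sum_congr rfl fun i _ => htight i
  have hflow : ∀ z ∈ splittings ι A, ∑ a, l a + η * ∑ k, |z k - x k.1 k.2| ≤ f z := by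
    intro z hz
    rw [← hsum z hz]
    have : ∑ i, ∑ a, l a * row z i a ≤ ∑ i, bobGain μ R (row z i) :=
      Finset.sum_le_sum fun i _ => hl _ fun a => hz.1 _
    simp only [hf]
    linarith
  -- a full-support reference point, obtained by mixing `x` with the uniform splitting
  obtain ⟨r, hr, hr0, hfr⟩ : ∃ r ∈ splittings ι A, (∀ k, 0 < r k) ∧
      f r < ∑ a, l a + η * ρ / 2 := by
    set n : ℝ := ((Fintype.card ι : ℕ) : ℝ) with hn
    have hn0 : 0 < n := Nat.cast_pos.2 Fintype.card_pos
    set r : ℝ → ι × A → ℝ := fun t k => (1 - t) * X k + t * n⁻¹ with hrdef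
    have hrc : Continuous r := continuous_pi fun k => by simp only [hrdef]; fun_prop
    have hrmem : ∀ t ∈ Set.Ioo (0 : ℝ) 1, r t ∈ splittings ι A := fun t ht =>
      ⟨fun k => add_nonneg (mul_nonneg (sub_pos.2 ht.2).le (hXK.1 k))
        (mul_nonneg ht.1.le (inv_pos.2 hn0).le), fun a => by
        simp only [hrdef, Finset.sum_add_distrib, ← Finset.mul_sum, hXK.2 a, Finset.sum_const,
          Finset.card_univ, nsmul_eq_mul, ← hn]
        field_simp
        ring⟩
    have hlim : Tendsto (fun t => f (r t)) (𝓝[>] 0) (𝓝 (f X)) := by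
      refine (hfc X hXK).tendsto.comp (tendsto_nhdsWithin_iff.2 ⟨?_, ?_⟩)
      · have h0 : r 0 = X := by ext k; simp [hrdef]
        rw [← h0]
        exact (hrc.tendsto 0).mono_left nhdsWithin_le_nhds
      · filter_upwards [Ioo_mem_nhdsGT one_pos] with t ht using hrmem t ht
    have hlt : f X < ∑ a, l a + η * ρ / 2 := by
      rw [hfX]
      have := mul_pos hη hρ
      linarith
    obtain ⟨t, h1, h2⟩ :=
      ((hlim.eventually_lt_const hlt).and (Ioo_mem_nhdsGT one_pos)).exists
    exact ⟨r t, hrmem t h2, fun k => add_pos_of_nonneg_of_pos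
      (mul_nonneg (sub_pos.2 h2.2).le (hXK.1 k)) (mul_pos h2.1 (inv_pos.2 hn0)), h1⟩
  -- the weight `c` keeps the barrier at `r` below `η * ρ / 2`, so that the minimizer is `ρ`-close
  set b := -∑ k, Real.log (r k) with hb
  have hb0 : 0 ≤ b := by
    rw [hb, ← Finset.sum_neg_distrib]
    exact Finset.sum_nonneg fun k _ => by
      simpa using Real.log_nonpos (hr0 k).le (le_one_of_mem_splittings hr k)
  set c := min κ (η * ρ / (2 * (b + 1))) with hcdef
  have hc : 0 < c := lt_min hκ (by positivity)
  have hcb : c * b ≤ η * ρ / 2 := by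
    have h1 : c * b ≤ η * ρ / (2 * (b + 1)) * b := mul_le_mul_of_nonneg_right (min_le_right _ _) hb0
    refine h1.trans ?_
    rw [div_mul_eq_mul_div, div_le_div_iff₀ (by positivity) two_pos]
    have : 0 ≤ η * ρ := by positivity
    nlinarith
  obtain ⟨z, hz, hz0, hmin⟩ := exists_barrier_minimizer isCompact_splittings
    (fun z hz k => le_one_of_mem_splittings hz k) hfc hc hr hr0
  have hdist : ∑ k, |z k - x k.1 k.2| ≤ ρ := by
    have h1 := hmin r hr hr0
    have h2 : 0 ≤ -∑ k, Real.log (z k) := by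
      rw [← Finset.sum_neg_distrib]
      exact Finset.sum_nonneg fun k _ => by
        simpa using Real.log_nonpos (hz0 k).le (le_one_of_mem_splittings hz k)
    have h3 := mul_nonneg hc.le h2
    have h4 := hflow z hz
    have h5 : η * ∑ k, |z k - x k.1 k.2| ≤ η * ρ := by
      have : c * b = -(c * ∑ k, Real.log (r k)) := by rw [hb]; ring
      linarith
    exact le_of_mul_le_mul_left h5 hη
  refine ⟨row z, fun i a => hz0 _, ?_, fun i a => ?_, fun i j a => ?_⟩
  · ext a
    rw [Finset.sum_apply]
    exact hz.2 a
  · exact (Finset.single_le_sum (f := fun k : ι × A => |z k - x k.1 k.2|)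
      (fun k _ => abs_nonneg _) (Finset.mem_univ (i, a))).trans hdist
  rcases eq_or_ne i j with rfl | hij
  · rw [sub_self, mul_zero, zero_add]
    have := mul_pos (mul_pos two_pos hη) (hz0 (i, a))
    exact (add_pos this hκ).le
  -- move the fraction `t` of the mass of type `a` at signal `j` to signal `i`
  set w := z (j, a) with hw
  have hw0 : 0 < w := hz0 _
  set d : ι × A → ℝ := fun k => (if k = (i, a) then 1 else 0) - (if k = (j, a) then 1 else 0)
    with hd
  set y : ℝ → ι × A → ℝ := fun t k => z k + t * w * d k with hy
  have hne : (i, a) ≠ (j, a) := fun h => hij (congrArg Prod.fst h)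
  have hylow : ∀ t ∈ Set.Ioo (0 : ℝ) 1, ∀ k,
      (if k = (j, a) then 1 - t else 1) * z k ≤ y t k := by
    intro t ht k
    simp only [hy, hd]
    by_cases h1 : k = (j, a)
    · subst h1
      rw [if_pos rfl, if_pos rfl, if_neg hne.symm, ← hw]
      linarith
    · rw [if_neg h1, if_neg h1]
      have : 0 ≤ t * w * ((if k = (i, a) then 1 else 0) - 0) :=
        mul_nonneg (mul_pos ht.1 hw0).le (by split_ifs <;> simp)
      linarith
  have hfac : ∀ t ∈ Set.Ioo (0 : ℝ) 1, ∀ k : ι × A, 0 < (if k = (j, a) then 1 - t else 1) := by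
    intro t ht k
    split_ifs
    · exact sub_pos.2 ht.2
    · exact one_pos
  have hypos : ∀ t ∈ Set.Ioo (0 : ℝ) 1, ∀ k, 0 < y t k := fun t ht k =>
    (mul_pos (hfac t ht k) (hz0 k)).trans_le (hylow t ht k)
  have hymem : ∀ t ∈ Set.Ioo (0 : ℝ) 1, y t ∈ splittings ι A := by
    refine fun t ht => ⟨fun k => (hypos t ht k).le, fun a' => ?_⟩
    simp only [hy, hd, Finset.sum_add_distrib, ← Finset.mul_sum, hz.2 a', Finset.sum_sub_distrib,
      Prod.mk.injEq]
    by_cases h : a' = a <;> simp [h]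
  have hineq : ∀ t ∈ Set.Ioo (0 : ℝ) 1,
      0 ≤ w * (devCost μ R (row (y t) i) (post μ (row z i)) a
        - devCost μ R (row (y t) j) (post μ (row z j)) a) + 2 * η * w + c / (1 - t) := by
    intro t ht
    have h1 := hmin (y t) (hymem t ht) (hypos t ht)
    have h2 : ∑ i, bobGain μ R (row (y t) i) - ∑ i, bobGain μ R (row z i) ≤
        t * w * (devCost μ R (row (y t) i) (post μ (row z i)) a
        - devCost μ R (row (y t) j) (post μ (row z j)) a) := by
      rw [← Finset.sum_sub_distrib]
      refine (Finset.sum_le_sum fun i' _ => hR.bobGain_sub_le (μ := μ) (x := row z i')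
        (y := row (y t) i') (fun a' => hz.1 _) (fun a' => (hypos t ht _).le)).trans_eq ?_
      rw [← Fintype.sum_prod_type' (f := fun i' a' => (row (y t) i' a' - row z i' a') *
        devCost μ R (row (y t) i') (post μ (row z i')) a')]
      have : ∀ k : ι × A, (row (y t) k.1 k.2 - row z k.1 k.2) *
          devCost μ R (row (y t) k.1) (post μ (row z k.1)) k.2 = t * w *
          ((if k = (i, a) then devCost μ R (row (y t) k.1) (post μ (row z k.1)) k.2 else 0)
          - (if k = (j, a) then devCost μ R (row (y t) k.1) (post μ (row z k.1)) k.2 else 0)) := by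
        intro k
        have : row (y t) k.1 k.2 - row z k.1 k.2 = t * w * d k := by
          simp only [hrow, hy]; ring
        rw [this]
        simp only [hd]
        split_ifs <;> ring
      rw [Finset.sum_congr rfl fun k _ => this k, ← Finset.mul_sum, Finset.sum_sub_distrib]
      simp
    have h3 : ∑ k, |y t k - x k.1 k.2| - ∑ k, |z k - x k.1 k.2| ≤ 2 * (t * w) := by
      rw [← Finset.sum_sub_distrib]
      have : ∀ k : ι × A, |y t k - x k.1 k.2| - |z k - x k.1 k.2| ≤
          t * w * ((if k = (i, a) then 1 else 0) + (if k = (j, a) then 1 else 0)) := by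
        intro k
        refine (abs_sub_abs_le_abs_sub _ _).trans ?_
        have e : y t k - x k.1 k.2 - (z k - x k.1 k.2) = t * w * d k := by
          simp only [hy]; ring
        rw [e, abs_mul, abs_of_pos (mul_pos ht.1 hw0)]
        refine mul_le_mul_of_nonneg_left ?_ (mul_pos ht.1 hw0).le
        simp only [hd]
        split_ifs <;> norm_num
      refine (Finset.sum_le_sum fun k _ => this k).trans_eq ?_
      rw [← Finset.mul_sum, Finset.sum_add_distrib]
      simp
      ring
    have h4 : ∑ k, Real.log (z k) + Real.log (1 - t) ≤ ∑ k, Real.log (y t k) := by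
      have : Real.log (1 - t) = ∑ k : ι × A, if k = (j, a) then Real.log (1 - t) else 0 := by simp
      rw [this, ← Finset.sum_add_distrib]
      refine Finset.sum_le_sum fun k _ => ?_
      refine le_trans (le_of_eq ?_) (Real.log_le_log (mul_pos (hfac t ht k) (hz0 k)) (hylow t ht k))
      rw [Real.log_mul (hfac t ht k).ne' (hz0 k).ne', add_comm]
      split_ifs <;> simp
    have h5 := neg_log_one_sub_le ht.2
    have h6 : c * (∑ k, Real.log (z k) - ∑ k, Real.log (y t k)) ≤ c * (t / (1 - t)) :=
      mul_le_mul_of_nonneg_left (by linarith) hc.le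
    have h7 := mul_le_mul_of_nonneg_left h3 hη.le
    simp only [hf] at h1
    have h8 : 0 ≤ t * (w * (devCost μ R (row (y t) i) (post μ (row z i)) a
        - devCost μ R (row (y t) j) (post μ (row z j)) a) + 2 * η * w + c / (1 - t)) := by
      have e1 : t * (c / (1 - t)) = c * (t / (1 - t)) := by ring
      linarith
    exact nonneg_of_mul_nonneg_right h8 ht.1
  have hyc : Continuous y := continuous_pi fun k => by simp only [hy]; fun_prop
  have hy0 : y 0 = z := by ext k; simp [hy]
  have hdev : ∀ i' p, Tendsto (fun t => devCost μ R (row (y t) i') p a) (𝓝[>] 0)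
      (𝓝 (devCost μ R (row z i') p a)) := fun i' p =>
    hR.tendsto_devCost_path (fun a' => hz.1 _) (hz0 (i', a)) p ((hrowc i').comp hyc)
      (congrArg (fun z => row z i') hy0) fun t ht a' => (hypos t ht _).le
  have hlim : Tendsto (fun t => w * (devCost μ R (row (y t) i) (post μ (row z i)) a
        - devCost μ R (row (y t) j) (post μ (row z j)) a) + 2 * η * w + c / (1 - t)) (𝓝[>] 0)
      (𝓝 (w * (devCost μ R (row z i) (post μ (row z i)) a
        - devCost μ R (row z j) (post μ (row z j)) a) + 2 * η * w + c / (1 - 0))) := by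
    refine ((((hdev i _).sub (hdev j _)).const_mul w).add_const _).add ?_
    refine Tendsto.mono_left ?_ nhdsWithin_le_nhds
    have : ContinuousAt (fun t : ℝ => c / (1 - t)) 0 :=
      continuousAt_const.div (by fun_prop) (by norm_num)
    exact this.tendsto
  have h0 := ge_of_tendsto hlim (by
    filter_upwards [Ioo_mem_nhdsGT one_pos] with t ht using hineq t ht)
  have hcκ : c ≤ κ := min_le_left _ _
  rw [sub_zero, div_one] at h0
  linarith

end Perturbation

section FullSupport

variable {E A B : Type*} [Fintype E] [Fintype A] [Fintype B] [Nonempty E]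
variable {μ : ProbVec (E × A × B)} {R : ProbVec E → E → ℝ}

/-- Arbitrarily close to an optimal scheme `x` there is a full-support scheme in which every type
pays, at every signal, at least her price up to `ε`. Each type `a` uses some signal of `x`, where
her cost is at least `l a` by tightness and remains so nearby; by the exchange inequality her cost
at the other signals cannot be much smaller. -/
theorem RegularScore.exists_perturbation (hR : RegularScore R) {l : A → ℝ}
    (hl : ∀ x : A → ℝ, 0 ≤ x → ∑ a, l a * x a ≤ bobGain μ R x)
    {ι : Type*} [Fintype ι] [Nonempty ι] {x : ι → A → ℝ} (hx : ∀ i, 0 ≤ x i)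
    (hx1 : ∑ i, x i = 1) (htight : ∀ i, bobGain μ R (x i) = ∑ a, l a * x i a)
    {ε : ℝ} (hε : 0 < ε) {U : Set (ι → A → ℝ)} (hU : U ∈ 𝓝 x) :
    ∃ z ∈ U, (∀ i a, 0 < z i a) ∧ ∑ i, z i = 1 ∧
      ∀ i a, l a - ε ≤ devCost μ R (z i) (post μ (z i)) a := by
  have hex : ∀ a, ∃ i, 0 < x i a := by
    intro a
    by_contra h
    push Not at h
    have h1 : ∑ i, x i a = 1 := by
      have := congrFun hx1 a
      rwa [Finset.sum_apply] at this
    linarith [Finset.sum_nonpos fun i (_ : i ∈ Finset.univ) => h i]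
  choose j hj using hex
  obtain ⟨ρ0, hρ0, hρU⟩ := Metric.nhds_basis_closedBall.mem_iff.1 hU
  have hev : ∀ a, ∃ r > 0, ∀ y : A → ℝ, 0 ≤ y → dist y (x (j a)) ≤ r →
      l a - ε / 2 < devCost μ R y (post μ y) a := by
    intro a
    have h1 := hR.price_le_devCost_of_tight hl (hx (j a)) (htight (j a)) (hj a)
    have h2 := (hR.tendsto_devCost_post (μ := μ) (hx (j a)) (hj a)).eventually_const_lt
      (show l a - ε / 2 < _ by linarith)
    obtain ⟨r, hr, h3⟩ := Metric.nhds_basis_closedBall.eventually_iff.1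
      (eventually_nhdsWithin_iff.1 h2)
    exact ⟨r, hr, fun y hy hd => h3 hd hy⟩
  choose r hr hrdev using hev
  have hρ : ∀ᶠ ρ : ℝ in 𝓝[>] 0, ρ ≤ ρ0 ∧ ∀ a, ρ ≤ r a ∧ ρ ≤ x (j a) a / 2 :=
    nhdsWithin_le_nhds ((eventually_le_nhds hρ0).and (eventually_all.2 fun a =>
      (eventually_le_nhds (hr a)).and (eventually_le_nhds (half_pos (hj a)))))
  obtain ⟨ρ, ⟨hρρ0, hρa⟩, hρpos⟩ := (hρ.and self_mem_nhdsWithin).exists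
  have hρpos : 0 < ρ := hρpos
  obtain ⟨z, hz0, hz1, hzx, hzex⟩ := hR.exists_perturbation_exchange hl hx hx1 htight
    (η := ε / 8) (ρ := ρ) (κ := ε / 4 * ρ) (by positivity) hρpos (by positivity)
  have hdist : ∀ i, dist (z i) (x i) ≤ ρ := fun i =>
    (dist_pi_le_iff hρpos.le).2 fun a => by rw [Real.dist_eq]; exact hzx i a
  refine ⟨z, hρU ?_, hz0, hz1, fun i a => ?_⟩
  · exact Metric.mem_closedBall.2 ((dist_pi_le_iff hρ0.le).2 fun i => (hdist i).trans hρρ0)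
  · have h1 := hrdev a (z (j a)) (fun a' => (hz0 _ a').le) ((hdist (j a)).trans (hρa a).1)
    have h2 := hzex i (j a) a
    have h3 : ρ ≤ z (j a) a := by
      have := (abs_le.1 (hzx (j a) a)).1
      have := (hρa a).2
      linarith
    have h4 : ε / 4 * ρ ≤ ε / 4 * z (j a) a := mul_le_mul_of_nonneg_left h3 (by positivity)
    have h5 : 0 ≤ z (j a) a * (devCost μ R (z i) (post μ (z i)) a
        - devCost μ R (z (j a)) (post μ (z (j a))) a + ε / 2) := by
      nlinarith
    have h6 := nonneg_of_mul_nonneg_right h5 (hz0 (j a) a)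
    linarith

/-- Signals of an optimal scheme with the same posterior can be merged: merging lowers Bob's gain
weakly, and it cannot fall below the supporting price. -/
theorem RegularScore.bobGain_sum_of_post_eq (hR : RegularScore R) {l : A → ℝ}
    (hl : ∀ x : A → ℝ, 0 ≤ x → ∑ a, l a * x a ≤ bobGain μ R x)
    {S : Type*} {t : Finset S} {u : S → A → ℝ} (hu : ∀ s ∈ t, 0 ≤ u s)
    (htight : ∀ s ∈ t, bobGain μ R (u s) = ∑ a, l a * u s a)
    (hpost : ∀ s ∈ t, post μ (u s) = post μ (∑ s ∈ t, u s)) :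
    bobGain μ R (∑ s ∈ t, u s) = ∑ a, l a * (∑ s ∈ t, u s) a := by
  refine le_antisymm ?_ (hl _ (Finset.sum_nonneg hu))
  rw [bobGain_eq_sum_mul_devCost]
  set v := ∑ s ∈ t, u s with hv
  have h1 : ∀ g : A → ℝ, ∑ a, v a * g a = ∑ s ∈ t, ∑ a, u s a * g a := by
    intro g
    rw [Finset.sum_comm]
    exact Finset.sum_congr rfl fun a _ => by rw [hv, Finset.sum_apply, Finset.sum_mul]
  rw [h1, show ∑ a, l a * v a = ∑ a, v a * l a from
    Finset.sum_congr rfl fun _ _ => mul_comm _ _, h1]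
  refine Finset.sum_le_sum fun s hs => ?_
  refine (hR.sum_mul_devCost_le (hu s hs) _).trans_eq ?_
  rw [← hpost s hs, ← bobGain_eq_sum_mul_devCost, htight s hs]
  exact Finset.sum_congr rfl fun _ _ => mul_comm _ _

/-- A summable family of vectors can be replaced by a finite subfamily, reweighted by factors close
to `1`, without changing the sum: the tail is a small vector in the span of the family, so it can be
absorbed by small changes of the coefficients of a basis of this span. -/
theorem exists_finite_reweighting {S : Type*} {v : S → A → ℝ} (hv : ∀ s, 0 ≤ v s)
    (hsum : ∀ a, HasSum (fun s => v s a) 1) {ε : ℝ} (hε : 0 < ε) :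
    ∃ (t : Finset S) (w : S → ℝ), (∀ s ∈ t, 0 < w s) ∧ (∀ s ∉ t, w s = 0) ∧
      (∀ s ∈ t, v s ≠ 0) ∧ ∑ s ∈ t, w s • v s = 1 ∧
      ∃ D ≤ ε, HasSum (fun s => ∑ a, |w s * v s a - v s a|) D := by
  classical
  obtain ⟨κ, k, hk, hspan, hli⟩ := exists_linearIndependent' ℝ v
  have : Finite κ := hli.finite
  let _ : Fintype κ := Fintype.ofFinite κ
  have hv1 : HasSum v 1 := Pi.hasSum.2 hsum
  set W := Submodule.span ℝ (Set.range v) with hW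
  have hvW : ∀ s, v s ∈ W := fun s => Submodule.subset_span ⟨s, rfl⟩
  have h1W : (1 : A → ℝ) ∈ W :=
    (Submodule.closed_of_finiteDimensional W).mem_of_tendsto hv1
      (Eventually.of_forall fun t => Submodule.sum_mem _ fun s _ => hvW s)
  have hrange : LinearMap.range (Fintype.linearCombination ℝ (v ∘ k)) = W := by
    rw [Fintype.range_linearCombination, hspan]
  obtain ⟨inv, hinv⟩ := LinearMap.exists_rightInverse_of_surjective
    (Fintype.linearCombination ℝ (v ∘ k)).rangeRestrict (LinearMap.range_rangeRestrict _)
  have hinvc : Continuous inv := inv.continuous_of_finiteDimensional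
  have htail : ∀ t : Finset S, 1 - ∑ s ∈ t, v s ∈
      LinearMap.range (Fintype.linearCombination ℝ (v ∘ k)) := fun t => by
    rw [hrange]
    exact Submodule.sub_mem _ h1W (Submodule.sum_mem _ fun s _ => hvW s)
  set c : Finset S → κ → ℝ := fun t => inv ⟨_, htail t⟩ with hc
  have hcsum : ∀ t, ∑ i, c t i • v (k i) = 1 - ∑ s ∈ t, v s := by
    intro t
    have h := LinearMap.congr_fun hinv ⟨_, htail t⟩
    have h' := congrArg Subtype.val h
    simpa [Fintype.linearCombination_apply] using h'
  have hct : Tendsto c atTop (𝓝 0) := by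
    rw [← map_zero inv]
    refine (hinvc.tendsto 0).comp (tendsto_subtype_rng.2 ?_)
    have : Tendsto (fun t : Finset S => 1 - ∑ s ∈ t, v s) atTop (𝓝 (1 - 1)) :=
      tendsto_const_nhds.sub hv1
    simpa using this
  set m : S → ℝ := fun s => ∑ a, v s a with hm
  have hm0 : ∀ s, 0 ≤ m s := fun s => Finset.sum_nonneg fun a _ => hv s a
  set n : ℝ := ∑ _a : A, (1 : ℝ) with hn
  have hn0 : 0 ≤ n := Finset.sum_nonneg fun _ _ => zero_le_one
  have hmsum : HasSum m n := hasSum_sum fun a _ => hsum a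
  set δ := min (1 / 2) (ε / (2 * (n + 1))) with hδ
  have hδ0 : 0 < δ := lt_min (by norm_num) (by positivity)
  have hδn : δ * n ≤ ε / 2 := by
    have h1 : δ * n ≤ ε / (2 * (n + 1)) * n := mul_le_mul_of_nonneg_right (min_le_right _ _) hn0
    refine h1.trans ?_
    rw [div_mul_eq_mul_div, div_le_div_iff₀ (by positivity) two_pos]
    nlinarith
  have hev1 : ∀ᶠ t in atTop, ∀ i, |c t i| < δ := by
    refine eventually_all.2 fun i => ?_
    have : Tendsto (fun t => |c t i|) atTop (𝓝 |(0 : κ → ℝ) i|) :=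
      (((continuous_apply i).tendsto _).comp hct).abs
    refine this.eventually_lt_const ?_
    simpa using hδ0
  have hev2 : ∀ᶠ t in atTop, n - ε / 2 < ∑ s ∈ t, m s :=
    hmsum.eventually_const_lt (by linarith)
  obtain ⟨t, ht1, ht2, ht3⟩ := (hev1.and (hev2.and
    (eventually_ge_atTop (Finset.univ.image k)))).exists
  set c' : S → ℝ := Function.extend k (c t) 0 with hc'
  have hc'k : ∀ i, c' (k i) = c t i := fun i => hk.extend_apply _ _ i
  have hc'bound : ∀ s, |c' s| ≤ δ := by
    intro s
    by_cases h : ∃ i, k i = s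
    · obtain ⟨i, rfl⟩ := h
      rw [hc'k]
      exact (ht1 i).le
    · rw [hc', Function.extend_apply' _ _ _ h]
      simpa using hδ0.le
  have hc'sum : ∑ s ∈ t, c' s • v s = 1 - ∑ s ∈ t, v s := by
    rw [← hcsum t]
    have h1 : ∑ s ∈ Finset.univ.image k, c' s • v s = ∑ i, c t i • v (k i) := by
      rw [Finset.sum_image fun i _ i' _ h => hk h]
      exact Finset.sum_congr rfl fun i _ => by rw [hc'k]
    rw [← h1]
    refine (Finset.sum_subset ht3 fun s _ hs => ?_).symm
    rw [hc', Function.extend_apply' _ _ _ (by simpa using hs)]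
    simp
  set t' := t.filter fun s => v s ≠ 0 with ht'
  have hD : ∀ s, ∑ a, |(if s ∈ t' then 1 + c' s else 0) * v s a - v s a| ≤
      δ * m s + (m s - if s ∈ t then m s else 0) := by
    intro s
    by_cases hs0 : v s = 0
    · simp [hs0, hm]
    have habs : ∀ q : ℝ, ∑ a, |q * v s a - v s a| = |q - 1| * m s := by
      intro q
      rw [hm, Finset.mul_sum]
      refine Finset.sum_congr rfl fun a _ => ?_
      rw [← sub_one_mul, abs_mul, abs_of_nonneg (hv s a)]
    rw [habs]
    by_cases hs : s ∈ t
    · have hs' : s ∈ t' := Finset.mem_filter.2 ⟨hs, hs0⟩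
      rw [if_pos hs', if_pos hs, add_sub_cancel_left, sub_self, add_zero]
      exact mul_le_mul_of_nonneg_right (hc'bound s) (hm0 s)
    · have hs' : s ∉ t' := fun h => hs (Finset.mem_filter.1 h).1
      rw [if_neg hs', if_neg hs]
      have := mul_nonneg hδ0.le (hm0 s)
      simp
      linarith
  have hDsum : HasSum (fun s => δ * m s + (m s - if s ∈ t then m s else 0))
      (δ * n + (n - ∑ s ∈ t, m s)) := by
    refine (hmsum.mul_left δ).add (hmsum.sub ?_)
    have : HasSum (fun s => if s ∈ t then m s else 0) (∑ s ∈ t, if s ∈ t then m s else 0) :=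
      hasSum_sum_of_ne_finset_zero fun s hs => if_neg hs
    rwa [Finset.sum_congr rfl fun s hs => if_pos hs] at this
  have hDs : Summable fun s => ∑ a, |(if s ∈ t' then 1 + c' s else 0) * v s a - v s a| :=
    Summable.of_nonneg_of_le (fun s => Finset.sum_nonneg fun a _ => abs_nonneg _) hD hDsum.summable
  refine ⟨t', fun s => if s ∈ t' then 1 + c' s else 0, fun s hs => ?_, fun s hs => if_neg hs,
    fun s hs => (Finset.mem_filter.1 hs).2, ?_, _, ?_, hDs.hasSum⟩
  · simp only [if_pos hs]
    have h1 := (abs_le.1 (hc'bound s)).1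
    have h2 : δ ≤ 1 / 2 := min_le_left _ _
    linarith
  · have h1 : ∑ s ∈ t', (1 + c' s) • v s = ∑ s ∈ t, (1 + c' s) • v s :=
      Finset.sum_subset (Finset.filter_subset _ _) fun s hs hs' => by
        have : v s = 0 := by
          by_contra h
          exact hs' (Finset.mem_filter.2 ⟨hs, h⟩)
        rw [this, smul_zero]
    refine (Finset.sum_congr rfl fun s hs => ?_).trans (h1.trans ?_)
    · simp only [if_pos hs]
    simp only [add_smul, one_smul, Finset.sum_add_distrib, hc'sum]
    abel
  · have h1 := hasSum_le hD hDs.hasSum hDsum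
    linarith

end FullSupport

/-! ### Signaling schemes in terms of likelihood vectors -/

section Schemes

variable {E A B S : Type*} [Fintype E] [Fintype A] [Fintype B]
variable {μ : ProbVec (E × A × B)}

theorem SignalingScheme.prob_eq_zero (π : SignalingScheme μ S) {a : A} (ha : probA μ a = 0)
    (s : S) : π.prob s a = 0 := by
  have h := π.marginal a
  rw [ha] at h
  exact congrFun ((hasSum_zero_iff_of_nonneg fun s => π.nonneg s a).1 h) s

/-- `Pr[S = s | A = a]`. For a type of probability zero, for which any conditional distribution
would do, this is the unconditional distribution of the signal. -/
def SignalingScheme.likelihood (π : SignalingScheme μ S) (s : S) (a : A) : ℝ :=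
  open Classical in if probA μ a = 0 then ∑ a', π.prob s a' else π.prob s a / probA μ a

theorem SignalingScheme.likelihood_nonneg (π : SignalingScheme μ S) (s : S) :
    0 ≤ π.likelihood s := by
  intro a
  simp only [SignalingScheme.likelihood]
  split_ifs
  · exact Finset.sum_nonneg fun a' _ => π.nonneg s a'
  · exact div_nonneg (π.nonneg s a) (probA_nonneg μ a)

theorem SignalingScheme.hasSum_likelihood (π : SignalingScheme μ S) (a : A) :
    HasSum (fun s => π.likelihood s a) 1 := by
  by_cases h : probA μ a = 0
  · simp only [SignalingScheme.likelihood, if_pos h]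
    rw [← sum_probA μ]
    exact hasSum_sum fun a' _ => π.marginal a'
  · simp only [SignalingScheme.likelihood, if_neg h]
    have := (π.marginal a).div_const (probA μ a)
    rwa [div_self h] at this

theorem SignalingScheme.prob_eq_mul_likelihood (π : SignalingScheme μ S) (s : S) (a : A) :
    π.prob s a = probA μ a * π.likelihood s a := by
  by_cases h : probA μ a = 0
  · rw [π.prob_eq_zero h, h, zero_mul]
  · rw [SignalingScheme.likelihood, if_neg h, mul_div_cancel₀ _ h]

theorem SignalingScheme.sum_jointE_likelihood_pos (π : SignalingScheme μ S) {s : S}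
    (h : π.likelihood s ≠ 0) : 0 < ∑ e, jointE μ (π.likelihood s) e := by
  rw [sum_jointE]
  have h1 : ∑ a, π.likelihood s a * probA μ a = ∑ a, π.prob s a :=
    Finset.sum_congr rfl fun a _ => by rw [π.prob_eq_mul_likelihood, mul_comm]
  rw [h1]
  refine (Finset.sum_nonneg fun a _ => π.nonneg s a).lt_of_ne' fun h0 => h ?_
  have h2 := (Finset.sum_eq_zero_iff_of_nonneg fun a _ => π.nonneg s a).1 h0
  ext a
  simp [SignalingScheme.likelihood, h0, h2 a (Finset.mem_univ a)]

/-- The scheme in which type `a` sends the signal `s` with probability `v s a`. -/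
def SignalingScheme.ofLikelihood (μ : ProbVec (E × A × B)) (v : S → A → ℝ) (hv : ∀ s, 0 ≤ v s)
    (hsum : ∀ a, HasSum (fun s => v s a) 1) : SignalingScheme μ S where
  prob s a := probA μ a * v s a
  nonneg s a := mul_nonneg (probA_nonneg μ a) (hv s a)
  marginal a := by simpa using (hsum a).mul_left (probA μ a)

theorem SignalingScheme.joint_eq (π : SignalingScheme μ S) {v : S → A → ℝ}
    (hv : ∀ s a, π.prob s a = probA μ a * v s a) (s : S) (e : E) (a : A) (b : B) :
    π.joint s e a b = v s a * μ (e, a, b) := by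
  rw [SignalingScheme.joint, hv, condEB]
  by_cases h : probA μ a = 0
  · rw [prior_eq_zero_of_probA h]; simp
  · field_simp

variable [Nonempty E]

theorem SignalingScheme.postS_eq (π : SignalingScheme μ S) {v : S → A → ℝ}
    (hv : ∀ s a, π.prob s a = probA μ a * v s a) (s : S) : π.postS s = post μ (v s) := by
  rw [SignalingScheme.postS, post]
  congr 1
  ext e
  simp only [π.joint_eq hv, jointE, jointB]
  exact Finset.sum_comm

theorem SignalingScheme.postSB_eq (π : SignalingScheme μ S) {v : S → A → ℝ}
    (hv : ∀ s a, π.prob s a = probA μ a * v s a) (s : S) (b : B) :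
    π.postSB s b = postB μ (v s) b := by
  rw [SignalingScheme.postSB, postB]
  congr 1
  ext e
  simp only [π.joint_eq hv, jointB]

variable {R : ProbVec E → E → ℝ}

theorem commitUtilityBob_eq (π : SignalingScheme μ S) {v : S → A → ℝ}
    (hv : ∀ s a, π.prob s a = probA μ a * v s a) :
    commitUtilityBob R π = ∑' s, bobGain μ R (v s) := by
  rw [commitUtilityBob]
  refine tsum_congr fun s => ?_
  rw [bobGain_eq_sum_mul_devCost, Finset.sum_comm]
  refine Finset.sum_congr rfl fun a _ => ?_
  rw [devCost, Finset.mul_sum, Finset.sum_comm]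
  refine Finset.sum_congr rfl fun b _ => ?_
  rw [Finset.mul_sum]
  refine Finset.sum_congr rfl fun e _ => ?_
  rw [π.joint_eq hv, π.postS_eq hv, π.postSB_eq hv, mul_assoc]

/-- An optimal scheme is supported by prices: there are numbers `l a` such that Bob gains at least
`∑ a, l a * x a` from any likelihood vector `x`, with equality at every signal of the scheme. -/
theorem RegularScore.exists_price_of_isOptimalScheme (hR : RegularScore R)
    (π : SignalingScheme μ S) (hopt : IsOptimalScheme R π) :
    ∃ l : A → ℝ, (∀ x : A → ℝ, 0 ≤ x → ∑ a, l a * x a ≤ bobGain μ R x) ∧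
      ∀ s, bobGain μ R (π.likelihood s) = ∑ a, l a * π.likelihood s a := by
  obtain ⟨M, hM⟩ := hR.exists_abs_bobGain_le (μ := μ)
  have hopt' : ∀ (n : ℕ) (x : Fin n → A → ℝ), (∀ i, 0 ≤ x i) → ∑ i, x i = 1 →
      commitUtilityBob R π ≤ ∑ i, bobGain μ R (x i) := by
    intro n x hx hx1
    have hs : ∀ a, HasSum (fun i => x i a) 1 := fun a => by
      have h := hasSum_fintype fun i => x i a
      have h1 := congrFun hx1 a
      rw [Finset.sum_apply] at h1
      rwa [h1] at h
    have h := hopt (Fin n) (SignalingScheme.ofLikelihood μ x hx hs)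
    rw [commitUtilityBob_eq (SignalingScheme.ofLikelihood μ x hx hs) (v := x) fun _ _ => rfl,
      tsum_fintype] at h
    exact h
  obtain ⟨l, hl, hlV⟩ := exists_supporting_price (F := bobGain μ R)
    (fun c x hc _ => bobGain_smul hc x) hM hopt'
  refine ⟨l, hl, fun s => ?_⟩
  have hsumm : Summable fun s => bobGain μ R (π.likelihood s) := by
    refine Summable.of_norm_bounded (g := fun s => M * ∑ a, π.likelihood s a) ?_
      fun s => hM _ (π.likelihood_nonneg s)
    exact ((hasSum_sum fun a _ => π.hasSum_likelihood a).mul_left M).summable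
  have hl1 : HasSum (fun s => ∑ a, l a * π.likelihood s a) (∑ a, l a) := by
    have := hasSum_sum (s := Finset.univ) fun a (_ : a ∈ Finset.univ) =>
      (π.hasSum_likelihood a).mul_left (l a)
    simpa using this
  rw [commitUtilityBob_eq π π.prob_eq_mul_likelihood] at hlV
  have hdiff := hsumm.hasSum.sub hl1
  have hnn : ∀ s, 0 ≤ bobGain μ R (π.likelihood s) - ∑ a, l a * π.likelihood s a := fun s =>
    sub_nonneg.2 (hl _ (π.likelihood_nonneg s))
  have h0 : ∑' s, bobGain μ R (π.likelihood s) - ∑ a, l a = 0 :=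
    le_antisymm (sub_nonpos.2 hlV) (hdiff.nonneg hnn)
  rw [h0] at hdiff
  exact sub_eq_zero.1 (congrFun ((hasSum_zero_iff_of_nonneg hnn).1 hdiff) s)

end Schemes

/-! ### Approximating an optimal scheme by a finite full-support scheme -/

section Approximation

variable {E A B S : Type*} [Fintype E] [Fintype A] [Fintype B] [Nonempty E]
variable {μ : ProbVec (E × A × B)} {R : ProbVec E → E → ℝ}

theorem exists_pos_mul_le {q r : ℝ} (hq : 0 ≤ q) (hr : 0 < r) :
    ∃ δ : ℝ, 0 < δ ∧ δ ≤ 1 ∧ δ * q ≤ r := by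
  refine ⟨min 1 (r / (q + 1)), lt_min one_pos (by positivity), min_le_left _ _, ?_⟩
  refine (mul_le_mul_of_nonneg_right (min_le_right _ _) hq).trans ?_
  rw [div_mul_eq_mul_div, div_le_iff₀ (by positivity)]
  exact mul_le_mul_of_nonneg_left (by linarith) hr.le

theorem tendsto_post {x : A → ℝ} (hx : 0 ≤ x) (hm : 0 < ∑ e, jointE μ x e) :
    Tendsto (post μ) (𝓝[{y | 0 ≤ y}] x) (𝓝 (post μ x)) := by
  refine (tendsto_normalizeVec (jointE_nonneg hx) hm).comp (tendsto_nhdsWithin_iff.2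
    ⟨(continuous_jointE.tendsto x).mono_left nhdsWithin_le_nhds, ?_⟩)
  filter_upwards [self_mem_nhdsWithin] with y hy using jointE_nonneg hy

theorem jointE_eq_mul_post {x : A → ℝ} (hx : 0 ≤ x) (e : E) :
    jointE μ x e = (∑ e, jointE μ x e) * post μ x e :=
  (sum_mul_normalizeVec (jointE_nonneg hx) e).symm

set_option maxHeartbeats 400000 in
/-- An optimal scheme `v` can be approximated by a finite full-support family `z` of merged signals,
in which different signals induce different posteriors and every type pays at every signal at least
her price up to `ε`, together with a scheme `y` on the original signals that splits every merged
signal into signals with the same posterior. The merged signals arise from the classes of signals of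
`v` with the same posterior. -/
theorem RegularScore.exists_fullSupport_scheme (hR : RegularScore R) {l : A → ℝ}
    (hl : ∀ x : A → ℝ, 0 ≤ x → ∑ a, l a * x a ≤ bobGain μ R x) {v : S → A → ℝ}
    (hv : ∀ s, 0 ≤ v s) (hsum : ∀ a, HasSum (fun s => v s a) 1)
    (htight : ∀ s, bobGain μ R (v s) = ∑ a, l a * v s a)
    (hmass : ∀ s, v s ≠ 0 → 0 < ∑ e, jointE μ (v s) e) {ε : ℝ} (hε : 0 < ε) :
    ∃ (ι : Finset (ProbVec E)) (z : ι → A → ℝ),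
      (∀ i a, 0 < z i a) ∧ (∑ i, z i = 1) ∧ (Function.Injective fun i => post μ (z i)) ∧
      (∀ i a, l a - ε ≤ devCost μ R (z i) (post μ (z i)) a) ∧
      (∑ i, bobGain μ R (z i) ≤ ∑ a, l a + ε) ∧
      ∃ (t : Finset S) (c : S → ι) (y : S → A → ℝ),
        (∀ s, 0 ≤ y s) ∧ (∀ s ∉ t, y s = 0) ∧ (∀ s ∈ t, post μ (y s) = post μ (z (c s))) ∧
        (∀ i, ∑ s ∈ t, (open Classical in if c s = i then y s else 0) = z i) ∧
        ∃ D ≤ ε, HasSum (fun s => ∑ a, |y s a - v s a|) D := by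
  classical
  have hA : Nonempty A := by
    by_contra h
    rw [not_nonempty_iff] at h
    have := sum_probA μ
    simp at this
  obtain ⟨t, w, hw, hw0, hvt, hwv, D, hD, hDsum⟩ :=
    exists_finite_reweighting hv hsum (half_pos hε)
  set u : S → A → ℝ := fun s => w s • v s with hu
  have hu0 : ∀ s, 0 ≤ u s := fun s => by
    by_cases hs : s ∈ t
    · exact smul_nonneg (hw s hs).le (hv s)
    · simp [hu, hw0 s hs]
  have hu1 : ∀ s ∈ t, ∀ a, u s a ≤ 1 := fun s hs a => by
    have h1 := congrFun hwv a
    rw [Finset.sum_apply, Pi.one_apply] at h1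
    rw [← h1]
    exact Finset.single_le_sum (f := fun s => u s a) (fun s _ => hu0 s a) hs
  have hum : ∀ s ∈ t, 0 < ∑ e, jointE μ (u s) e := fun s hs => by
    simp only [hu, jointE_smul, ← Finset.mul_sum]
    exact mul_pos (hw s hs) (hmass s (hvt s hs))
  have hupost : ∀ s ∈ t, post μ (u s) = post μ (v s) := fun s hs => by
    simp only [hu, post, jointE_smul]
    exact normalizeVec_smul (hw s hs).ne' _
  have hutight : ∀ s ∈ t, bobGain μ R (u s) = ∑ a, l a * u s a := fun s hs => by
    simp only [hu, bobGain_smul (hw s hs).le, htight s, Finset.mul_sum, Pi.smul_apply, smul_eq_mul]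
    exact Finset.sum_congr rfl fun a _ => by ring
  set ι : Finset (ProbVec E) := t.image fun s => post μ (v s) with hι
  have hιne : Nonempty ι := by
    by_contra h
    rw [not_nonempty_iff, Finset.isEmpty_coe_sort, hι, Finset.image_eq_empty] at h
    obtain ⟨a⟩ := hA
    have := congrFun hwv a
    simp [h] at this
  set c : S → ι := fun s => if h : s ∈ t then ⟨post μ (v s), Finset.mem_image_of_mem _ h⟩
    else Classical.arbitrary ι with hc
  have hcval : ∀ s ∈ t, (c s : ProbVec E) = post μ (v s) := fun s hs => by
    simp only [hc, dif_pos hs]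
  -- the merged signals: one for each posterior
  set x : ι → A → ℝ := fun i => ∑ s ∈ t with c s = i, u s with hx
  have hx0 : ∀ i, 0 ≤ x i := fun i => Finset.sum_nonneg fun s _ => hu0 s
  have hx1 : ∑ i, x i = 1 := by
    rw [← hwv]
    exact Finset.sum_fiberwise t c u
  have hxle : ∀ i a, x i a ≤ 1 := fun i a => by
    have h1 := congrFun hx1 a
    rw [Finset.sum_apply, Pi.one_apply] at h1
    rw [← h1]
    exact Finset.single_le_sum (f := fun i => x i a) (fun i _ => hx0 i a) (Finset.mem_univ i)
  set m : S → ℝ := fun s => ∑ e, jointE μ (u s) e with hm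
  set N : ι → ℝ := fun i => ∑ s ∈ t with c s = i, m s with hN
  have hxJ : ∀ i e, jointE μ (x i) e = N i * (i : ProbVec E) e := by
    intro i e
    rw [hx, jointE_sum, hN, Finset.sum_mul]
    refine Finset.sum_congr rfl fun s hs => ?_
    obtain ⟨hst, hsi⟩ := Finset.mem_filter.1 hs
    rw [jointE_eq_mul_post (hu0 s), hupost s hst, ← hcval s hst, hsi]
  have hNle : ∀ s ∈ t, m s ≤ N (c s) := fun s hs =>
    Finset.single_le_sum (f := m) (fun s' hs' => (hum s' (Finset.mem_filter.1 hs').1).le)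
      (Finset.mem_filter.2 ⟨hs, rfl⟩)
  have hN0 : ∀ i, 0 < N i := by
    intro i
    obtain ⟨s, hs, hsi⟩ := Finset.mem_image.1 i.2
    have hci : c s = i := Subtype.ext ((hcval s hs).trans hsi)
    exact hci ▸ (hum s hs).trans_le (hNle s hs)
  have hxpost : ∀ i, post μ (x i) = i := fun i =>
    normalizeVec_eq_of_forall_mul (hN0 i) _ (hxJ i)
  have hxm : ∀ i, 0 < ∑ e, jointE μ (x i) e := fun i => by
    simp only [hxJ, ← Finset.mul_sum]
    have := (i : ProbVec E).2.2
    change 0 < N i * ∑ e, (i : ProbVec E).1 e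
    rw [this, mul_one]
    exact hN0 i
  have hxtight : ∀ i, bobGain μ R (x i) = ∑ a, l a * x i a := fun i => by
    refine hR.bobGain_sum_of_post_eq hl (fun s _ => hu0 s)
      (fun s hs => hutight s (Finset.mem_filter.1 hs).1) fun s hs => ?_
    obtain ⟨hst, hsi⟩ := Finset.mem_filter.1 hs
    refine (hupost s hst).trans ((hcval s hst).symm.trans ?_)
    rw [hsi]
    exact (hxpost i).symm
  set q : ℝ := ∑ _s ∈ t, ∑ _a : A, (3 : ℝ) with hq
  have hq0 : 0 ≤ q := Finset.sum_nonneg fun _ _ => Finset.sum_nonneg fun _ _ => by norm_num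
  obtain ⟨δ, hδ0, hδ1, hδq⟩ := exists_pos_mul_le hq0 (half_pos hε)
  -- everything that is required of `z` apart from the prices holds near `x`
  have hcont : ∀ i a, Tendsto (fun z : ι → A → ℝ => z i a) (𝓝 x) (𝓝 (x i a)) := fun i a =>
    (by fun_prop : Continuous fun z : ι → A → ℝ => z i a).tendsto x
  have hwithin : ∀ i, Tendsto (fun z : ι → A → ℝ => z i) (𝓝[{z | ∀ i, 0 ≤ z i}] x)
      (𝓝[{y | 0 ≤ y}] (x i)) := fun i =>
    tendsto_nhdsWithin_iff.2 ⟨((continuous_apply i).tendsto x).mono_left nhdsWithin_le_nhds, by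
      filter_upwards [self_mem_nhdsWithin] with z hz using hz i⟩
  have ev1 : ∀ᶠ z : ι → A → ℝ in 𝓝 x, ∀ i a, 0 < x i a → (1 - δ) * x i a < z i a :=
    eventually_all.2 fun i => eventually_all.2 fun a => by
      by_cases h : 0 < x i a
      · filter_upwards [(hcont i a).eventually_const_lt
          (show (1 - δ) * x i a < x i a from (mul_lt_iff_lt_one_left h).2 (by linarith))]
          with z hz _ using hz
      · exact Eventually.of_forall fun z hz => absurd hz h
  have ev2 : ∀ᶠ z : ι → A → ℝ in 𝓝 x, ∀ i a, |z i a - x i a| < δ :=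
    eventually_all.2 fun i => eventually_all.2 fun a => by
      have : Tendsto (fun z : ι → A → ℝ => |z i a - x i a|) (𝓝 x) (𝓝 |x i a - x i a|) :=
        ((hcont i a).sub_const _).abs
      exact this.eventually_lt_const (by simpa using hδ0)
  have ev3 : ∀ᶠ z : ι → A → ℝ in 𝓝[{z | ∀ i, 0 ≤ z i}] x, ∀ i j, i ≠ j →
      post μ (z i) ≠ post μ (z j) :=
    eventually_all.2 fun i => eventually_all.2 fun j => by
      by_cases h : i = j
      · exact Eventually.of_forall fun z hz => absurd h hz
      · have h1 := (tendsto_post (hx0 i) (hxm i)).comp (hwithin i)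
        have h2 := (tendsto_post (hx0 j) (hxm j)).comp (hwithin j)
        rw [hxpost] at h1 h2
        have hij : ((i : ProbVec E), (j : ProbVec E)) ∈ (Set.diagonal (ProbVec E))ᶜ :=
          fun h' => h (Subtype.ext h')
        filter_upwards [(h1.prodMk_nhds h2).eventually
          (isClosed_diagonal.isOpen_compl.mem_nhds hij)] with z hz _ using hz
  have ev4 : ∀ᶠ z : ι → A → ℝ in 𝓝[{z | ∀ i, 0 ≤ z i}] x,
      ∑ i, bobGain μ R (z i) < ∑ a, l a + ε := by
    have h1 : Tendsto (fun z : ι → A → ℝ => ∑ i, bobGain μ R (z i))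
        (𝓝[{z | ∀ i, 0 ≤ z i}] x) (𝓝 (∑ i, bobGain μ R (x i))) :=
      tendsto_finsetSum _ fun i _ =>
        (hR.continuousOn_bobGain (x i) (hx0 i)).tendsto.comp (hwithin i)
    refine h1.eventually_lt_const ?_
    have h2 : ∑ i, bobGain μ R (x i) = ∑ a, l a := by
      rw [Finset.sum_congr rfl fun i _ => hxtight i, Finset.sum_comm]
      refine Finset.sum_congr rfl fun a _ => ?_
      have h3 := congrFun hx1 a
      rw [Finset.sum_apply, Pi.one_apply] at h3
      rw [← Finset.mul_sum, h3, mul_one]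
    linarith
  obtain ⟨z, ⟨hz1, hz2, hz34⟩, hzpos, hzsum, hzdev⟩ := hR.exists_perturbation hl hx0 hx1 hxtight hε
    (ev1.and (ev2.and (eventually_nhdsWithin_iff.1 (ev3.and ev4))))
  obtain ⟨hz3, hz4⟩ := hz34 fun i a => (hzpos i a).le
  have hzx : ∀ i a, 0 ≤ z i a - (1 - δ) * x i a := by
    intro i a
    rcases (hx0 i a).eq_or_lt with h | h
    · rw [← show (0 : ℝ) = x i a from h, mul_zero, sub_zero]
      exact (hzpos i a).le
    · exact sub_nonneg.2 (hz1 i a h).le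
  -- `s` keeps the part `(1 - δ) • u s` of its mass and gets the share `θ s` of what the merged
  -- signal has in addition to `(1 - δ) • x`; this choice gives `y s`
  -- the posterior of `z (c s)`
  set θ : S → ℝ := fun s => m s / N (c s) with hθ
  have hθ0 : ∀ s ∈ t, 0 < θ s := fun s hs => div_pos (hum s hs) (hN0 _)
  have hθ1 : ∀ s ∈ t, θ s ≤ 1 := fun s hs => (div_le_one (hN0 _)).2 (hNle s hs)
  have hθsum : ∀ i, ∑ s ∈ t with c s = i, θ s = 1 := by
    intro i
    have : ∑ s ∈ t with c s = i, θ s = ∑ s ∈ t with c s = i, m s / N i :=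
      Finset.sum_congr rfl fun s hs => by rw [hθ, ← (Finset.mem_filter.1 hs).2]
    rw [this, ← Finset.sum_div]
    exact div_self (hN0 i).ne'
  set y : S → A → ℝ := fun s => if s ∈ t then
    (1 - δ) • u s + θ s • (z (c s) + (-(1 - δ)) • x (c s)) else 0 with hy
  have hyt : ∀ s ∈ t, y s = (1 - δ) • u s + θ s • (z (c s) + (-(1 - δ)) • x (c s)) :=
    fun s hs => by simp only [hy, if_pos hs]
  have hyt' : ∀ s ∉ t, y s = 0 := fun s hs => by simp only [hy, if_neg hs]
  refine ⟨ι, z, hzpos, hzsum, fun i j hij => ?_, hzdev, hz4.le, t, c, y, fun s => ?_, hyt',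
    fun s hs => ?_, fun i => ?_, ?_⟩
  · by_contra h
    exact hz3 i j h hij
  · by_cases hs : s ∈ t
    · rw [hyt s hs]
      intro a
      have h1 := mul_nonneg (sub_nonneg.2 hδ1) (hu0 s a)
      have h2 := mul_nonneg (hθ0 s hs).le (hzx (c s) a)
      simp only [Pi.add_apply, Pi.smul_apply, smul_eq_mul, Pi.zero_apply] at h1 ⊢
      linarith
    · rw [hyt' s hs]
  · have hJ : jointE μ (y s) = fun e => θ s * jointE μ (z (c s)) e := by
      ext e
      have h1 : jointE μ (u s) e = m s * (c s : ProbVec E) e := by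
        rw [jointE_eq_mul_post (hu0 s), hupost s hs, ← hcval s hs]
      have h2 : θ s * N (c s) = m s := div_mul_cancel₀ _ (hN0 _).ne'
      rw [hyt s hs]
      simp only [jointE_add, jointE_smul, Pi.add_apply, h1, hxJ]
      rw [← h2]
      ring
    rw [post, hJ]
    exact normalizeVec_smul (hθ0 s hs).ne' _
  · rw [← Finset.sum_filter]
    have h1 : ∑ s ∈ t with c s = i, y s = ∑ s ∈ t with c s = i,
        ((1 - δ) • u s + θ s • (z i + (-(1 - δ)) • x i)) :=
      Finset.sum_congr rfl fun s hs => by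
        obtain ⟨hst, hsi⟩ := Finset.mem_filter.1 hs
        rw [hyt s hst, hsi]
    rw [h1, Finset.sum_add_distrib, ← Finset.smul_sum, ← Finset.sum_smul, hθsum, one_smul]
    change (1 - δ) • x i + _ = _
    rw [neg_smul]
    abel
  · have hb : ∀ s, ∑ a, |y s a - v s a| ≤
        (if s ∈ t then ∑ _a : A, 3 * δ else 0) + ∑ a, |w s * v s a - v s a| := by
      intro s
      by_cases hs : s ∈ t
      · rw [if_pos hs, ← Finset.sum_add_distrib]
        refine Finset.sum_le_sum fun a _ => ?_
        have h1 : |y s a - u s a| ≤ 3 * δ := by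
          have e1 : y s a - u s a =
              θ s * (z (c s) a - x (c s) a) + (θ s * δ * x (c s) a - δ * u s a) := by
            rw [hyt s hs]
            simp only [Pi.add_apply, Pi.smul_apply, smul_eq_mul]
            ring
          have h2 : |θ s * (z (c s) a - x (c s) a)| ≤ δ := by
            rw [abs_mul, abs_of_pos (hθ0 s hs)]
            exact (mul_le_of_le_one_left (abs_nonneg _) (hθ1 s hs)).trans (hz2 _ a).le
          have h3 : 0 ≤ θ s * δ * x (c s) a :=
            mul_nonneg (mul_pos (hθ0 s hs) hδ0).le (hx0 (c s) a)
          have h4 : θ s * δ * x (c s) a ≤ δ :=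
            (mul_le_of_le_one_right (mul_pos (hθ0 s hs) hδ0).le (hxle _ a)).trans
              (mul_le_of_le_one_left hδ0.le (hθ1 s hs))
          have h5 : 0 ≤ δ * u s a := mul_nonneg hδ0.le (hu0 s a)
          have h6 : δ * u s a ≤ δ := mul_le_of_le_one_right hδ0.le (hu1 s hs a)
          rw [e1]
          rw [abs_le] at h2 ⊢
          constructor <;> linarith [h2.1, h2.2]
        have h7 : u s a = w s * v s a := rfl
        rw [h7] at h1
        exact (abs_sub_le _ _ _).trans (add_le_add_left h1 _)
      · rw [if_neg hs, hyt' s hs, hw0 s hs, zero_add]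
        simp
    have hbsum : HasSum (fun s => (if s ∈ t then ∑ _a : A, 3 * δ else 0) +
        ∑ a, |w s * v s a - v s a|) (δ * q + D) := by
      refine HasSum.add ?_ hDsum
      have h1 : HasSum (fun s => if s ∈ t then ∑ _a : A, 3 * δ else 0)
          (∑ s ∈ t, if s ∈ t then ∑ _a : A, 3 * δ else 0) :=
        hasSum_sum_of_ne_finset_zero fun s hs => if_neg hs
      rw [Finset.sum_congr rfl fun s hs => if_pos hs] at h1
      convert h1 using 1
      simp only [hq, Finset.mul_sum, mul_comm]
    have hs : Summable fun s => ∑ a, |y s a - v s a| :=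
      Summable.of_nonneg_of_le (fun s => Finset.sum_nonneg fun a _ => abs_nonneg _) hb
        hbsum.summable
    have := hasSum_le hb hs.hasSum hbsum
    exact ⟨_, by linarith, hs.hasSum⟩

end Approximation

/-! ### Lotteries -/

section Lotteries

variable {X ι : Type*}

theorem Lottery.expect_add (L : Lottery X) (f g : X → ℝ) :
    L.expect (fun x => f x + g x) = L.expect f + L.expect g := by
  simp only [Lottery.expect, Finsupp.sum, mul_add, Finset.sum_add_distrib]

theorem Lottery.expect_const_mul (L : Lottery X) (c : ℝ) (f : X → ℝ) :
    L.expect (fun x => c * f x) = c * L.expect f := by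
  simp only [Lottery.expect, Finsupp.sum, Finset.mul_sum]
  exact Finset.sum_congr rfl fun _ _ => by ring

theorem Lottery.expect_const (L : Lottery X) (c : ℝ) : L.expect (fun _ => c) = c := by
  have h := L.total
  simp only [Finsupp.sum] at h
  simp only [Lottery.expect, Finsupp.sum, ← Finset.sum_mul, h, one_mul]

theorem Lottery.expect_sum (L : Lottery X) (s : Finset ι) (f : ι → X → ℝ) :
    L.expect (fun x => ∑ i ∈ s, f i x) = ∑ i ∈ s, L.expect (f i) := by
  simp only [Lottery.expect, Finsupp.sum, Finset.mul_sum]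
  exact Finset.sum_comm

theorem Lottery.expect_mono (L : Lottery X) {f g : X → ℝ} (h : ∀ x, f x ≤ g x) :
    L.expect f ≤ L.expect g :=
  Finset.sum_le_sum fun x _ => mul_le_mul_of_nonneg_left (h x) (L.nonneg x)

theorem Lottery.expect_le (L : Lottery X) {f : X → ℝ} {c : ℝ} (h : ∀ x, f x ≤ c) :
    L.expect f ≤ c := (L.expect_mono h).trans_eq (L.expect_const c)

theorem Lottery.expect_single (x : X) (f : X → ℝ) :
    Lottery.expect (Convexity.StdSimplex.single x : Lottery X) f = f x := by
  simp [Lottery.expect]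

/-- The lottery that yields `p i` with probability `w i`. -/
def Lottery.ofFamily [Fintype ι] (w : ι → ℝ) (hw : ∀ i, 0 ≤ w i) (hw1 : ∑ i, w i = 1) (p : ι → X) :
    Lottery X where
  weights := ∑ i, Finsupp.single (p i) (w i)
  nonneg := Finset.sum_nonneg fun i _ => Finsupp.single_nonneg.2 (hw i)
  total := by
    classical
    rw [← Finsupp.sum_finsetSum_index (by simp) (by simp)]
    simpa using hw1

theorem Lottery.expect_ofFamily [Fintype ι] (w : ι → ℝ) (hw : ∀ i, 0 ≤ w i) (hw1 : ∑ i, w i = 1)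
    (p : ι → X) (f : X → ℝ) :
    (Lottery.ofFamily w hw hw1 p).expect f = ∑ i, w i * f (p i) := by
  classical
  rw [Lottery.expect, Lottery.ofFamily, ← Finsupp.sum_finsetSum_index (by simp)
    (by simp [add_mul])]
  simp

theorem Lottery.weights_ofFamily [Fintype ι] (w : ι → ℝ) (hw : ∀ i, 0 ≤ w i) (hw1 : ∑ i, w i = 1)
    (p : ι → X) (x : X) :
    (Lottery.ofFamily w hw hw1 p).weights x =
      ∑ i, (open Classical in if p i = x then w i else 0) := by
  classical
  rw [Lottery.ofFamily, Finsupp.finsetSum_apply]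
  exact Finset.sum_congr rfl fun i _ => Finsupp.single_apply

end Lotteries

/-! ### Bob's reports -/

/-- Distinct representatives of a finite family of infinite sets. -/
theorem exists_injective_mem {X B : Type*} [Finite B] (U : B → Set X) (hU : ∀ b, (U b).Infinite) :
    ∃ f : B → X, Function.Injective f ∧ ∀ b, f b ∈ U b := by
  classical
  have := Fintype.ofFinite B
  have key : ∀ s : Finset B, ∃ f : B → X, Set.InjOn f s ∧ ∀ b, f b ∈ U b := by
    intro s
    induction s using Finset.induction_on with
    | empty => exact ⟨fun b => (hU b).nonempty.some, by simp, fun b => (hU b).nonempty.some_mem⟩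
    | insert b s hb ih =>
      obtain ⟨f, hf, hfU⟩ := ih
      obtain ⟨x, hxU, hxs⟩ := ((hU b).sdiff (s.finite_toSet.image f)).nonempty
      have hne : ∀ c ∈ s, Function.update f b x c = f c := fun c hc =>
        Function.update_of_ne (ne_of_mem_of_not_mem hc hb) _ _
      refine ⟨Function.update f b x, ?_, fun c => ?_⟩
      · rw [Finset.coe_insert, Set.injOn_insert (by simpa using hb)]
        refine ⟨fun c hc d hd h => hf hc hd ?_, ?_⟩
        · rwa [hne c hc, hne d hd] at h
        · rintro ⟨c, hc, h⟩
          rw [hne c hc, Function.update_self] at h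
          exact hxs ⟨c, hc, h⟩
      · rcases eq_or_ne c b with rfl | h
        · rwa [Function.update_self]
        · rw [Function.update_of_ne h]
          exact hfU c
  obtain ⟨f, hf, hfU⟩ := key Finset.univ
  exact ⟨f, fun b c h => hf (by simp) (by simp) h, hfU⟩

section Reports

variable {E A B : Type*} [Fintype E] [Fintype A] [Fintype B] [Nonempty E]
variable {R : ProbVec E → E → ℝ}

/-- Predictions `q b` can be perturbed slightly so that they reveal `b`, unless there is only one
prediction to make. -/
theorem RegularScore.exists_revealing_reports (hR : RegularScore R) (q : B → ProbVec E) {ε : ℝ}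
    (hε : 0 < ε) : ∃ r : B → ProbVec E,
      (Function.Injective r ∨ Subsingleton (ProbVec E)) ∧
      ∀ b e, 0 < q b e → |R (r b) e - R (q b) e| ≤ ε := by
  rcases subsingleton_or_nontrivial (ProbVec E) with h | h
  · exact ⟨q, Or.inr h, fun b e _ => by simpa using hε.le⟩
  · have hU : ∀ b, {r : ProbVec E | ∀ e, 0 < q b e → |R r e - R (q b) e| ≤ ε} ∈ 𝓝 (q b) := by
      intro b
      refine eventually_all.2 fun e => ?_
      by_cases he : 0 < q b e
      · have := Metric.tendsto_nhds.1 (hR.tendsto (q b) e he) ε hε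
        filter_upwards [this] with r hr _
        rw [Real.dist_eq] at hr
        exact hr.le
      · exact Eventually.of_forall fun r hr => absurd hr he
    obtain ⟨r, hr, hrU⟩ := exists_injective_mem _ fun b => infinite_of_mem_nhds (q b) (hU b)
    exact ⟨r, Or.inl hr, hrU⟩

end Reports

/-! ### Beliefs and continuation play -/

section Beliefs

variable {E A B : Type*} [Fintype E] [Fintype A] [Fintype B]
variable {μ : ProbVec (E × A × B)} {R : ProbVec E → E → ℝ}

theorem sum_probAB_left (μ : ProbVec (E × A × B)) (b : B) : ∑ a, probAB μ a b = probB μ b :=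
  Finset.sum_comm

theorem sum_probAB_right (μ : ProbVec (E × A × B)) (a : A) : ∑ b, probAB μ a b = probA μ a :=
  Finset.sum_comm

theorem sum_jointB (l : A → ℝ) (b : B) : ∑ e, jointB μ l b e = ∑ a, probAB μ a b * l a := by
  simp only [jointB, probAB, Finset.sum_mul]
  rw [Finset.sum_comm]
  exact Finset.sum_congr rfl fun a _ => Finset.sum_congr rfl fun e _ => mul_comm _ _

theorem sum_probAB_mul_pos {l : A → ℝ} (hl : ∀ a, 0 < l a) {b : B} (hb : 0 < probB μ b) :
    0 < ∑ a, probAB μ a b * l a := by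
  rw [← sum_probAB_left] at hb
  obtain ⟨a, ha, hab⟩ := Finset.exists_lt_of_sum_lt (f := fun _ => (0 : ℝ))
    (g := fun a => probAB μ a b) (s := Finset.univ) (by simpa using hb)
  exact (mul_pos hab (hl a)).trans_le (Finset.single_le_sum (f := fun a => probAB μ a b * l a)
    (fun a _ => mul_nonneg (probAB_nonneg μ a b) (hl a).le) ha)

theorem probAB_mul_condE (a : A) (b : B) (e : E) : probAB μ a b * condE μ a b e = μ (e, a, b) := by
  by_cases h : probAB μ a b = 0
  · rw [h, zero_mul, prior_eq_zero_of_probAB h]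
  · rw [condE, mul_div_cancel₀ _ h]

theorem probA_mul_condEB (a : A) (e : E) (b : B) : probA μ a * condEB μ a e b = μ (e, a, b) := by
  by_cases h : probA μ a = 0
  · rw [h, zero_mul, prior_eq_zero_of_probA h]
  · rw [condEB, mul_div_cancel₀ _ h]

theorem isBayesUpdate_normalizeVec {X : Type*} [Fintype X] [Nonempty X] {w l : X → ℝ}
    (hw : ∀ x, 0 ≤ w x) (hl : ∀ x, 0 ≤ l x) (h : 0 < ∑ x, w x * l x) :
    IsBayesUpdate w l (normalizeVec fun x => w x * l x) := by
  have h0 : (0 : X → ℝ) ≤ fun x => w x * l x := fun x => mul_nonneg (hw x) (hl x)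
  refine ⟨fun x hx => ?_, fun x => sum_mul_normalizeVec h0 x⟩
  rw [normalizeVec_apply h0 h, hx, zero_mul, zero_div]

theorem isBayesUpdate_of_sum_eq_zero {X : Type*} [Fintype X] [Nonempty X] {w l : X → ℝ}
    (hw : ∀ x, 0 ≤ w x) (hl : ∀ x, 0 ≤ l x) (hw0 : 0 < ∑ x, w x) (h : ∑ x, w x * l x = 0) :
    IsBayesUpdate w l (normalizeVec w) := by
  refine ⟨fun x hx => ?_, fun x => ?_⟩
  · rw [normalizeVec_apply hw hw0, hx, zero_div]
  · rw [h, zero_mul]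
    exact ((Finset.sum_eq_zero_iff_of_nonneg fun x _ => mul_nonneg (hw x) (hl x)).1 h x
      (Finset.mem_univ x)).symm

theorem sum_mul_expect {X ι : Type*} [Fintype ι] (q : Lottery X) (x : ι → ℝ) (f : ι → X → ℝ) :
    ∑ i, x i * q.expect (f i) = q.expect fun p => ∑ i, x i * f i p := by
  rw [Lottery.expect_sum]
  exact Finset.sum_congr rfl fun i _ => (q.expect_const_mul _ _).symm

/-- Bob's belief on Alice's signal, given his signal `b` and the likelihood vector `l` that he
attributes to Alice's report. -/
def bobBelief [Nonempty A] (μ : ProbVec (E × A × B)) (l : A → ℝ) (b : B) : ProbVec A :=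
  normalizeVec fun a => probAB μ a b * l a

theorem mul_interimBob [Nonempty A] {l : A → ℝ} (hl : 0 ≤ l) (b : B) (p1 : ProbVec E)
    (q : Lottery (ProbVec E)) :
    (∑ a, probAB μ a b * l a) * interimBob μ R b p1 (bobBelief μ l b) q =
      ∑ e, jointB μ l b e * q.expect fun p2 => bobPayoff R p1 p2 e := by
  have h0 : (0 : A → ℝ) ≤ fun a => probAB μ a b * l a := fun a =>
    mul_nonneg (probAB_nonneg μ a b) (hl a)
  have hJ : ∀ e, jointB μ l b e * (q.expect fun p2 => bobPayoff R p1 p2 e) =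
      ∑ a, l a * μ (e, a, b) * q.expect fun p2 => bobPayoff R p1 p2 e := fun e => by
    rw [jointB, Finset.sum_mul]
  rw [interimBob, Finset.mul_sum, Finset.sum_congr rfl fun e _ => hJ e,
    Finset.sum_comm (s := (Finset.univ : Finset E))]
  refine Finset.sum_congr rfl fun a _ => ?_
  rw [← mul_assoc, bobBelief, sum_mul_normalizeVec h0, Finset.mul_sum]
  refine Finset.sum_congr rfl fun e _ => ?_
  rw [← probAB_mul_condE (μ := μ) a b e]
  ring

variable [Nonempty E]

theorem postB_pos {l : A → ℝ} (hl : 0 ≤ l) {b : B} {e : E} (h : 0 < jointB μ l b e) :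
    0 < postB μ l b e := by
  have hs : 0 < ∑ e, jointB μ l b e := h.trans_le
    (Finset.single_le_sum (fun e _ => jointB_nonneg hl b e) (Finset.mem_univ e))
  rw [postB, normalizeVec_apply (jointB_nonneg hl b) hs]
  exact div_pos h hs

/-- A report close to Bob's posterior is optimal for him up to `ε`. -/
theorem RegularScore.sum_jointB_mul_expect_le (hR : RegularScore R) {l : A → ℝ} (hl : 0 ≤ l) {b : B}
    {r : ProbVec E} {ε : ℝ} (hr : ∀ e, 0 < postB μ l b e → |R r e - R (postB μ l b) e| ≤ ε)
    (p1 : ProbVec E) (q : Lottery (ProbVec E)) :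
    ∑ e, jointB μ l b e * q.expect (fun p2 => bobPayoff R p1 p2 e) ≤
      ∑ e, jointB μ l b e * bobPayoff R p1 r e + ε * ∑ e, jointB μ l b e := by
  rw [sum_mul_expect]
  refine Lottery.expect_le _ fun p2 => ?_
  have h1 := hR.sum_mul_le_score (jointB_nonneg (μ := μ) hl b) p2
  have h2 : score R (jointB μ l b) ≤
      ∑ e, jointB μ l b e * R r e + ε * ∑ e, jointB μ l b e := by
    rw [score, Finset.mul_sum, ← Finset.sum_add_distrib]
    refine Finset.sum_le_sum fun e _ => ?_
    rcases (jointB_nonneg (μ := μ) hl b e).eq_or_lt with h | h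
    · rw [← show (0 : ℝ) = jointB μ l b e from h]; simp
    · have h3 := (abs_le.1 (hr e (postB_pos hl h))).1
      rw [mul_comm ε, ← mul_add]
      refine mul_le_mul_of_nonneg_left ?_ h.le
      change R (postB μ l b) e ≤ _
      linarith
  simp only [bobPayoff, mul_sub, Finset.sum_sub_distrib]
  linarith

/-- Alice's optimal report in round 3 under the belief `α` on Bob's signal. -/
def finalReport (μ : ProbVec (E × A × B)) (a : A) (α : ProbVec B) : ProbVec E :=
  normalizeVec fun e => ∑ b, α b * condE μ a b e

theorem RegularScore.interimAlice3_le (hR : RegularScore R) (p0 : ProbVec E) (a : A)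
    (p1 p2 : ProbVec E) (α : ProbVec B) (q : Lottery (ProbVec E)) :
    interimAlice3 μ R p0 a p1 p2 α q ≤
      interimAlice3 μ R p0 a p1 p2 α (Convexity.StdSimplex.single (finalReport μ a α)) := by
  set x : E → ℝ := fun e => ∑ b, α b * condE μ a b e with hx
  have hx0 : 0 ≤ x := fun e => Finset.sum_nonneg fun b _ =>
    mul_nonneg (α.2.1 b) (div_nonneg (μ.2.1 _) (probAB_nonneg μ a b))
  have key : ∀ q : Lottery (ProbVec E), interimAlice3 μ R p0 a p1 p2 α q =
      q.expect fun p3 => ∑ e, x e * alicePayoff R p0 p1 p2 p3 e := by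
    intro q
    rw [← sum_mul_expect]
    simp only [interimAlice3, hx, Finset.mul_sum, Finset.sum_mul]
    rw [Finset.sum_comm]
    exact Finset.sum_congr rfl fun e _ => Finset.sum_congr rfl fun b _ => by ring
  rw [key, key, Lottery.expect_single]
  refine Lottery.expect_le _ fun p3 => ?_
  have h := hR.sum_mul_le_score hx0 p3
  rw [score] at h
  simp only [alicePayoff, mul_add, mul_sub, Finset.sum_add_distrib, Finset.sum_sub_distrib]
  change _ ≤ _ + (∑ e, x e * R (normalizeVec x) e - _)
  linarith

open Classical in
/-- Alice's belief on Bob's signal, given her signal `a` and the likelihood vector `l` that she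
attributes to Bob's report; her prior belief if `a` contradicts that report. -/
def aliceBelief [Nonempty B] (μ : ProbVec (E × A × B)) (a : A) (l : B → ℝ) : ProbVec B :=
  if 0 < ∑ b, probAB μ a b * l b then normalizeVec fun b => probAB μ a b * l b
  else normalizeVec fun b => probAB μ a b

theorem isBayesUpdate_aliceBelief [Nonempty B] {a : A} (ha : 0 < probA μ a) {l : B → ℝ}
    (hl : ∀ b, 0 ≤ l b) : IsBayesUpdate (fun b => probAB μ a b) l (aliceBelief μ a l) := by
  have h0 : ∀ b, 0 ≤ probAB μ a b := fun b => probAB_nonneg μ a b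
  rw [aliceBelief]
  split_ifs with h
  · exact isBayesUpdate_normalizeVec h0 hl h
  · refine isBayesUpdate_of_sum_eq_zero h0 hl ?_ (le_antisymm (not_lt.1 h)
      (Finset.sum_nonneg fun b _ => mul_nonneg (h0 b) (hl b)))
    rw [sum_probAB_right]
    exact ha

/-- Once Bob's report has revealed his signal, Alice's final report is the posterior given all
signals. -/
theorem finalReport_aliceBelief [Nonempty B] {a : A} {b : B} (hab : 0 < probAB μ a b) {l : B → ℝ}
    (hlb : l b = 1) (hl : ∀ b', b' ≠ b → l b' = 0) :
    finalReport μ a (aliceBelief μ a l) = normalizeVec fun e => μ (e, a, b) := by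
  classical
  have hsum : ∑ b', probAB μ a b' * l b' = probAB μ a b := by
    rw [Finset.sum_eq_single b (fun b' _ h => by rw [hl b' h, mul_zero]) (by simp), hlb, mul_one]
  have hl0 : ∀ b', 0 ≤ l b' := fun b' => by
    by_cases h : b' = b
    · rw [h, hlb]; exact zero_le_one
    · rw [hl b' h]
  have h0 : (0 : B → ℝ) ≤ fun b' => probAB μ a b' * l b' := fun b' =>
    mul_nonneg (probAB_nonneg μ a b') (hl0 b')
  have hbel : ∀ b', aliceBelief μ a l b' = l b' := by
    intro b'
    rw [aliceBelief, if_pos (hsum ▸ hab), normalizeVec_apply h0 (hsum ▸ hab), hsum]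
    by_cases h : b' = b
    · rw [h, hlb, mul_one, div_self hab.ne']
    · rw [hl b' h, mul_zero, zero_div]
  have hvec : (fun e => ∑ b', aliceBelief μ a l b' * condE μ a b' e) =
      fun e => (probAB μ a b)⁻¹ * μ (e, a, b) := by
    ext e
    rw [Finset.sum_eq_single b (fun b' _ h => by rw [hbel, hl b' h, zero_mul]) (by simp), hbel, hlb,
      one_mul, condE, div_eq_inv_mul]
  rw [finalReport, hvec]
  exact normalizeVec_smul (inv_ne_zero hab.ne') _

end Beliefs

/-! ### Alice's payoffs -/

section Alice

variable {E A B : Type*} [Fintype E] [Fintype A] [Fintype B]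
variable {μ : ProbVec (E × A × B)} {R : ProbVec E → E → ℝ}

theorem utilityAlice_eq (p0 : ProbVec E) (σ1 : Strategy1 E A) (σ3 : Strategy3 E A)
    (σ2 : Strategy2 E B) : utilityAlice μ R p0 σ1 σ3 σ2 =
      ∑ a, probA μ a * interimAlice1 μ R p0 σ2 a (σ1 a) (σ3 a) := by
  rw [utilityAlice, Finset.sum_comm]
  refine Finset.sum_congr rfl fun a _ => ?_
  rw [interimAlice1, Finset.mul_sum]
  refine Finset.sum_congr rfl fun e _ => ?_
  rw [Finset.mul_sum]
  refine Finset.sum_congr rfl fun b _ => ?_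
  rw [← mul_assoc, probA_mul_condEB]

theorem probA_mul_interimAlice1 (p0 : ProbVec E) (r : B → ProbVec E → ProbVec E) (a : A)
    (q : Lottery (ProbVec E)) (τ : ProbVec E → ProbVec E → Lottery (ProbVec E)) :
    probA μ a * interimAlice1 μ R p0 (fun b p1 => Convexity.StdSimplex.single (r b p1)) a q τ =
      q.expect fun p1 => ∑ b, ∑ e, μ (e, a, b) * ((R p1 e - R p0 e) +
        ((τ p1 (r b p1)).expect (fun p3 => R p3 e) - R (r b p1) e)) := by
  rw [interimAlice1, Lottery.expect_sum]
  simp only [Finset.mul_sum]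
  rw [Finset.sum_comm]
  refine Finset.sum_congr rfl fun b _ => ?_
  rw [Lottery.expect_sum]
  refine Finset.sum_congr rfl fun e _ => ?_
  rw [← mul_assoc, probA_mul_condEB, ← Lottery.expect_const_mul]
  congr 1
  ext p1
  rw [Lottery.expect_single]
  congr 1
  have h : (fun p3 => alicePayoff R p0 p1 (r b p1) p3 e) =
      fun p3 => (R p1 e - R p0 e - R (r b p1) e) + R p3 e := by
    ext p3
    rw [alicePayoff]
    ring
  rw [h, Lottery.expect_add, Lottery.expect_const]
  ring

theorem sum_alice_split (p0 p1 : ProbVec E) (a : A) (g : B → E → ℝ) (r : B → ProbVec E) :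
    ∑ b, ∑ e, μ (e, a, b) * ((R p1 e - R p0 e) + (g b e - R (r b) e)) =
      ∑ b, (∑ e, μ (e, a, b) * g b e - ∑ e, μ (e, a, b) * R p0 e) -
        ∑ b, ∑ e, μ (e, a, b) * (R (r b) e - R p1 e) := by
  rw [← Finset.sum_sub_distrib]
  refine Finset.sum_congr rfl fun b _ => ?_
  rw [← Finset.sum_sub_distrib, ← Finset.sum_sub_distrib]
  exact Finset.sum_congr rfl fun e _ => by ring

theorem sum_prior_right (a : A) : ∑ b, ∑ e, μ (e, a, b) = probA μ a := Finset.sum_comm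

variable [Nonempty E]

/-- The expected score, weighted with `Pr[A = a]`, that type `a` of Alice collects over the initial
prediction when the market ends with the posterior given all signals. -/
def fullValue (μ : ProbVec (E × A × B)) (R : ProbVec E → E → ℝ) (p0 : ProbVec E) (a : A) : ℝ :=
  ∑ b, (score R (fun e => μ (e, a, b)) - ∑ e, μ (e, a, b) * R p0 e)

/-- `devCost` is what type `a` of Alice loses to Bob, up to `δ`, if Bob's reports are almost as good
as the posteriors that the likelihood vector `l` induces. -/
theorem abs_sum_sub_devCost_le {l : A → ℝ} (hl : ∀ a, 0 < l a) {r : B → ProbVec E} {δ : ℝ}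
    (hr : ∀ b e, 0 < postB μ l b e → |R (r b) e - R (postB μ l b) e| ≤ δ) (p1 : ProbVec E) (a : A) :
    |∑ b, ∑ e, μ (e, a, b) * (R (r b) e - R p1 e) - devCost μ R l p1 a| ≤ δ * probA μ a := by
  rw [devCost, ← Finset.sum_sub_distrib, ← sum_prior_right, Finset.mul_sum]
  refine (Finset.abs_sum_le_sum_abs _ _).trans (Finset.sum_le_sum fun b _ => ?_)
  rw [← Finset.sum_sub_distrib, Finset.mul_sum]
  refine (Finset.abs_sum_le_sum_abs _ _).trans (Finset.sum_le_sum fun e _ => ?_)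
  rw [← mul_sub, abs_mul, sub_sub_sub_cancel_right,
    abs_of_nonneg (show 0 ≤ μ (e, a, b) from μ.2.1 _), mul_comm]
  rcases (μ.2.1 (e, a, b)).eq_or_lt with h | h
  · have h' : μ (e, a, b) = 0 := h.symm
    rw [h', mul_zero, mul_zero]
  · refine mul_le_mul_of_nonneg_right (hr b e (postB_pos (fun a => (hl a).le) ?_)) h.le
    exact (mul_pos (hl a) h).trans_le (Finset.single_le_sum (f := fun a => l a * μ (e, a, b))
      (fun a _ => mul_nonneg (hl a).le (μ.2.1 _)) (Finset.mem_univ a))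

/-- Whatever Alice reports in the end, a type whose first report is `p1` attains no more than her
full-information value minus what she loses to Bob. -/
theorem RegularScore.sum_alice_le (hR : RegularScore R) {l : A → ℝ} (hl : ∀ a, 0 < l a)
    {r : B → ProbVec E} {δ : ℝ}
    (hr : ∀ b e, 0 < postB μ l b e → |R (r b) e - R (postB μ l b) e| ≤ δ) (p0 p1 : ProbVec E)
    (a : A) (q : B → Lottery (ProbVec E)) :
    ∑ b, ∑ e, μ (e, a, b) * ((R p1 e - R p0 e) + ((q b).expect (fun p3 => R p3 e) - R (r b) e)) ≤
      fullValue μ R p0 a - devCost μ R l p1 a + δ * probA μ a := by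
  rw [sum_alice_split]
  have h1 := (abs_le.1 (abs_sum_sub_devCost_le hl hr p1 a)).1
  have h2 : ∑ b, (∑ e, μ (e, a, b) * (q b).expect (fun p3 => R p3 e) - ∑ e, μ (e, a, b) * R p0 e) ≤
      fullValue μ R p0 a := by
    refine Finset.sum_le_sum fun b _ => sub_le_sub_right ?_ _
    rw [sum_mul_expect]
    exact Lottery.expect_le _ fun p3 => hR.sum_mul_le_score (fun e => μ.2.1 _) p3
  linarith

/-- Alice attains the bound of `RegularScore.sum_alice_le`, up to errors, if her final reports are
as good as the posteriors given all signals. -/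
theorem le_sum_alice {l : A → ℝ} (hl : ∀ a, 0 < l a) {r : B → ProbVec E} {δ : ℝ}
    (hr : ∀ b e, 0 < postB μ l b e → |R (r b) e - R (postB μ l b) e| ≤ δ) (p0 p1 : ProbVec E)
    (a : A) {p3 : B → ProbVec E}
    (hp3 : ∀ b, ∑ e, μ (e, a, b) * R (p3 b) e = score R fun e => μ (e, a, b)) :
    fullValue μ R p0 a - devCost μ R l p1 a - δ * probA μ a ≤
      ∑ b, ∑ e, μ (e, a, b) * ((R p1 e - R p0 e) + (R (p3 b) e - R (r b) e)) := by
  have h := sum_alice_split (μ := μ) (R := R) p0 p1 a (fun b e => R (p3 b) e) r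
  have h1 := (abs_le.1 (abs_sum_sub_devCost_le hl hr p1 a)).2
  have h2 : ∑ b, (∑ e, μ (e, a, b) * R (p3 b) e - ∑ e, μ (e, a, b) * R p0 e) =
      fullValue μ R p0 a := Finset.sum_congr rfl fun b _ => by rw [hp3]
  linarith

end Alice

/-! ### The equilibrium -/

section Equilibrium

variable {E A B : Type*} [Fintype E] [Fintype A] [Fintype B] [Nonempty E]
variable {μ : ProbVec (E × A × B)} {R : ProbVec E → E → ℝ}

theorem utilityBob_ofFamily {ι : Type*} [Fintype ι] {z : ι → A → ℝ} (hz : ∀ i a, 0 ≤ z i a)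
    (hz1 : ∀ a, ∑ i, z i a = 1) (p : ι → ProbVec E) (σ2 : Strategy2 E B) :
    utilityBob μ R (fun a => Lottery.ofFamily (fun i => z i a) (fun i => hz i a) (hz1 a) p) σ2 =
      ∑ i, ∑ b, ∑ e, jointB μ (z i) b e *
        (σ2 b (p i)).expect fun p2 => bobPayoff R (p i) p2 e := by
  simp only [utilityBob, Lottery.expect_ofFamily, jointB, Finset.mul_sum, Finset.sum_mul]
  have h1 : ∀ e : E, ∑ a, ∑ b, ∑ i, μ (e, a, b) * (z i a *
      (σ2 b (p i)).expect fun p2 => bobPayoff R (p i) p2 e) =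
      ∑ i, ∑ b, ∑ a, z i a * μ (e, a, b) *
      (σ2 b (p i)).expect fun p2 => bobPayoff R (p i) p2 e := by
    intro e
    rw [Finset.sum_comm]
    simp_rw [Finset.sum_comm (s := (Finset.univ : Finset A)) (t := (Finset.univ : Finset ι))]
    rw [Finset.sum_comm]
    refine Finset.sum_congr rfl fun i _ => Finset.sum_congr rfl fun b _ =>
      Finset.sum_congr rfl fun a _ => by ring
  rw [Finset.sum_congr rfl fun e _ => h1 e, Finset.sum_comm]
  exact Finset.sum_congr rfl fun i _ => Finset.sum_comm

/-- A finite full-support scheme `z` in which every type pays almost her price at every signal is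
the first round of an equilibrium. Bob attributes to a report on the path its likelihood vector and
to any other report a deterring one; he reports almost his posterior and reveals his signal, so that
Alice can end the market at the posterior given all signals. Type `a` then loses at least `l a - δ`
to Bob after every report. As Bob's total gain is at most `∑ a, l a + δ`, she loses at most
`l a + card A * δ` when she plays `z`, and the two errors in Bob's reports account for the remaining
`2 * δ` of the condition `hδA`. -/
theorem RegularScore.exists_isEpsPBE (hR : RegularScore R) (p0 : ProbVec E) {l : A → ℝ}
    (hl : ∀ x : A → ℝ, 0 ≤ x → ∑ a, l a * x a ≤ bobGain μ R x)
    {ι : Type*} [Fintype ι] {z : ι → A → ℝ} (hz : ∀ i a, 0 < z i a) (hz1 : ∑ i, z i = 1)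
    (hinj : Function.Injective fun i => post μ (z i)) {δ ε : ℝ} (hδ : 0 < δ)
    (hdev : ∀ i a, l a - δ ≤ devCost μ R (z i) (post μ (z i)) a)
    (hgain : ∑ i, bobGain μ R (z i) ≤ ∑ a, l a + δ) (hδε : δ ≤ ε)
    (hδA : ∀ a, 0 < probA μ a → ((Fintype.card A : ℝ) + 3) * δ ≤ ε * probA μ a) :
    ∃ (σ1 : Strategy1 E A) (σ3 : Strategy3 E A) (σ2 : Strategy2 E B)
      (β : B → ProbVec E → ProbVec A) (α : A → ProbVec E → ProbVec E → ProbVec B),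
      IsEpsPBE μ R p0 ε σ1 σ3 σ2 β α ∧ ∀ a p, (σ1 a).weights p =
        ∑ i, (open Classical in if post μ (z i) = p then z i a else 0) := by
  classical
  have hA : Nonempty A := by
    by_contra h
    rw [not_nonempty_iff] at h
    have := sum_probA μ
    simp at this
  have hB : Nonempty B := by
    by_contra h
    rw [not_nonempty_iff] at h
    have := sum_prior μ
    simp at this
  have hz1a : ∀ a, ∑ i, z i a = 1 := fun a => by
    have := congrFun hz1 a
    rwa [Finset.sum_apply] at this
  -- the likelihood vector that Bob attributes to a report, on or off the path
  have hlik : ∀ p, ∃ x : A → ℝ, (∀ a, 0 < x a) ∧ (∀ a, l a - δ ≤ devCost μ R x p a) ∧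
      ∀ i, post μ (z i) = p → x = z i := by
    intro p
    by_cases h : ∃ i, post μ (z i) = p
    · obtain ⟨i, rfl⟩ := h
      exact ⟨z i, hz i, hdev i, fun j hj => congrArg z (hinj hj).symm⟩
    · obtain ⟨x, hx, hxd⟩ := hR.exists_deterring_likelihood hl p hδ
      exact ⟨x, hx, hxd, fun i hi => absurd ⟨i, hi⟩ h⟩
  choose lik hlik0 hlikd hlikz using hlik
  have hlik0' : ∀ p, 0 ≤ lik p := fun p a => (hlik0 p a).le
  choose r hrinj hr using fun p1 => hR.exists_revealing_reports (fun b => postB μ (lik p1) b) hδ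
  set σ1 : Strategy1 E A := fun a => Lottery.ofFamily (fun i => z i a) (fun i => (hz i a).le)
    (hz1a a) fun i => post μ (z i) with hσ1
  set σ2 : Strategy2 E B := fun b p1 => Convexity.StdSimplex.single (r p1 b) with hσ2
  set lik2 : ProbVec E → ProbVec E → B → ℝ := fun p1 p2 =>
    if ∃ b, 0 < probB μ b ∧ 0 < (σ2 b p1).weights p2 then fun b => (σ2 b p1).weights p2
    else fun _ => 1 with hlik2
  have hlik20 : ∀ p1 p2 b, 0 ≤ lik2 p1 p2 b := by
    intro p1 p2 b
    simp only [hlik2]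
    split_ifs
    · exact (σ2 b p1).nonneg p2
    · exact zero_le_one
  set β : B → ProbVec E → ProbVec A := fun b p1 => bobBelief μ (lik p1) b with hβ
  set α : A → ProbVec E → ProbVec E → ProbVec B := fun a p1 p2 =>
    aliceBelief μ a (lik2 p1 p2) with hα
  set σ3 : Strategy3 E A := fun a p1 p2 =>
    Convexity.StdSimplex.single (finalReport μ a (α a p1 p2)) with hσ3
  have hσ1w : ∀ a p, (σ1 a).weights p = ∑ i, if post μ (z i) = p then z i a else 0 :=
    fun a p => by
      convert Lottery.weights_ofFamily (fun i => z i a) (fun i => (hz i a).le) (hz1a a)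
        (fun i => post μ (z i)) p
  have hσ2w : ∀ b p1 p2, (σ2 b p1).weights p2 = if r p1 b = p2 then 1 else 0 := fun b p1 p2 =>
    Finsupp.single_apply
  -- after a report of Bob on the path, Alice's final report attains the full-information score
  have hfinal : ∀ a p1 b, ∑ e, μ (e, a, b) * R (finalReport μ a (α a p1 (r p1 b))) e =
      score R fun e => μ (e, a, b) := by
    intro a p1 b
    rcases (probAB_nonneg μ a b).eq_or_lt with h | h
    · simp only [score, prior_eq_zero_of_probAB h.symm, zero_mul, Finset.sum_const_zero]
    rcases hrinj p1 with hinj' | hsub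
    · have hb : 0 < probB μ b := by
        rw [← sum_probAB_left]
        exact h.trans_le (Finset.single_le_sum (f := fun a => probAB μ a b)
          (fun a _ => probAB_nonneg μ a b) (Finset.mem_univ a))
      have hex : ∃ b', 0 < probB μ b' ∧ 0 < (σ2 b' p1).weights (r p1 b) :=
        ⟨b, hb, by rw [hσ2w, if_pos rfl]; exact one_pos⟩
      have hval : ∀ b', lik2 p1 (r p1 b) b' = if r p1 b' = r p1 b then 1 else 0 := fun b' => by
        simp only [hlik2, if_pos hex]
        exact hσ2w b' p1 _
      rw [score, hα, finalReport_aliceBelief h (by rw [hval, if_pos rfl])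
        fun b' hb' => by rw [hval, if_neg (hinj'.ne hb')]]
    · exact Finset.sum_congr rfl fun e _ => by rw [Subsingleton.elim (finalReport μ a _) _]
  -- the costs sum to at most `∑ a, l a + δ` and each is at least `l a - δ`
  have hcost : ∀ a, ∑ i, z i a * devCost μ R (z i) (post μ (z i)) a ≤
      l a + (Fintype.card A : ℝ) * δ := by
    intro a
    have h1 : ∀ a, l a - δ ≤ ∑ i, z i a * devCost μ R (z i) (post μ (z i)) a := fun a => by
      calc l a - δ = ∑ i, z i a * (l a - δ) := by rw [← Finset.sum_mul, hz1a, one_mul]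
        _ ≤ _ := Finset.sum_le_sum fun i _ => mul_le_mul_of_nonneg_left (hdev i a) (hz i a).le
    have h2 : ∑ a, ∑ i, z i a * devCost μ R (z i) (post μ (z i)) a ≤ ∑ a, l a + δ := by
      rw [Finset.sum_comm]
      refine le_trans (le_of_eq ?_) hgain
      exact Finset.sum_congr rfl fun i _ => (bobGain_eq_sum_mul_devCost _).symm
    have h3 := Finset.single_le_sum (f := fun a =>
      ∑ i, z i a * devCost μ R (z i) (post μ (z i)) a - (l a - δ))
      (fun a _ => sub_nonneg.2 (h1 a)) (Finset.mem_univ a)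
    simp only [Finset.sum_sub_distrib, Finset.sum_const, Finset.card_univ, nsmul_eq_mul] at h3
    linarith
  have halice : ∀ a, 0 < probA μ a → ∀ q τ,
      interimAlice1 μ R p0 σ2 a q τ ≤ interimAlice1 μ R p0 σ2 a (σ1 a) (σ3 a) + ε := by
    intro a ha q τ
    have hPA := probA_le_one μ a
    have hup : probA μ a * interimAlice1 μ R p0 σ2 a q τ ≤
        fullValue μ R p0 a - l a + 2 * δ := by
      rw [probA_mul_interimAlice1 p0 (fun b p1 => r p1 b)]
      refine Lottery.expect_le _ fun p1 => ?_
      have h1 := hR.sum_alice_le (hlik0 p1) (hr p1) p0 p1 a fun b => τ p1 (r p1 b)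
      have h2 := hlikd p1 a
      have h3 : δ * probA μ a ≤ δ := mul_le_of_le_one_right hδ.le hPA
      linarith
    have hlow : fullValue μ R p0 a - l a - (Fintype.card A : ℝ) * δ - δ ≤
        probA μ a * interimAlice1 μ R p0 σ2 a (σ1 a) (σ3 a) := by
      rw [probA_mul_interimAlice1 p0 (fun b p1 => r p1 b), hσ1, Lottery.expect_ofFamily]
      have h1 : ∀ i, z i a * (fullValue μ R p0 a - devCost μ R (z i) (post μ (z i)) a - δ) ≤
          z i a * ∑ b, ∑ e, μ (e, a, b) * ((R (post μ (z i)) e - R p0 e) +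
            ((σ3 a (post μ (z i)) (r (post μ (z i)) b)).expect (fun p3 => R p3 e)
              - R (r (post μ (z i)) b) e)) := by
        intro i
        refine mul_le_mul_of_nonneg_left ?_ (hz i a).le
        have h2 := le_sum_alice (hlik0 _) (hr (post μ (z i))) p0 (post μ (z i)) a
          (hfinal a (post μ (z i)))
        rw [hlikz _ i rfl] at h2
        have h3 : δ * probA μ a ≤ δ := mul_le_of_le_one_right hδ.le hPA
        simp only [hσ3, Lottery.expect_single]
        linarith
      refine le_trans ?_ (Finset.sum_le_sum fun i _ => h1 i)
      have h4 : ∑ i, z i a * (fullValue μ R p0 a - devCost μ R (z i) (post μ (z i)) a - δ) =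
          fullValue μ R p0 a - ∑ i, z i a * devCost μ R (z i) (post μ (z i)) a - δ := by
        simp only [mul_sub, Finset.sum_sub_distrib, ← Finset.sum_mul, hz1a, one_mul]
      have h5 := hcost a
      linarith
    have h6 := hδA a ha
    have h7 : probA μ a * interimAlice1 μ R p0 σ2 a q τ ≤
        probA μ a * (interimAlice1 μ R p0 σ2 a (σ1 a) (σ3 a) + ε) := by
      rw [mul_add, mul_comm (probA μ a) ε]
      linarith
    exact le_of_mul_le_mul_left h7 ha
  refine ⟨σ1, σ3, σ2, β, α, ⟨?_, ?_, ⟨?_, ?_⟩, halice, ?_, ?_⟩, fun a p => by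
    convert hσ1w a p⟩
  · intro σ1' σ3'
    rw [utilityAlice_eq, utilityAlice_eq]
    have h1 : ∑ a, probA μ a * interimAlice1 μ R p0 σ2 a (σ1 a) (σ3 a) + ε =
        ∑ a, probA μ a * (interimAlice1 μ R p0 σ2 a (σ1 a) (σ3 a) + ε) := by
      simp only [mul_add, Finset.sum_add_distrib, ← Finset.sum_mul, sum_probA, one_mul]
    rw [h1]
    refine Finset.sum_le_sum fun a _ => ?_
    rcases (probA_nonneg μ a).eq_or_lt with h | h
    · rw [← h, zero_mul, zero_mul]
    · exact mul_le_mul_of_nonneg_left (halice a h _ _) h.le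
  · intro σ2'
    rw [hσ1, utilityBob_ofFamily (fun i a => (hz i a).le) hz1a,
      utilityBob_ofFamily (fun i a => (hz i a).le) hz1a]
    have h1 : ∀ i b, ∑ e, jointB μ (z i) b e * ((σ2' b (post μ (z i))).expect fun p2 =>
        bobPayoff R (post μ (z i)) p2 e) ≤
        ∑ e, jointB μ (z i) b e * ((σ2 b (post μ (z i))).expect fun p2 =>
        bobPayoff R (post μ (z i)) p2 e) + δ * ∑ e, jointB μ (z i) b e := by
      intro i b
      have h2 := hr (post μ (z i)) b
      rw [hlikz _ i rfl] at h2
      simp only [hσ2, Lottery.expect_single]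
      exact hR.sum_jointB_mul_expect_le (fun a => (hz i a).le) h2 _ _
    have h3 : ∑ i, ∑ b, δ * ∑ e, jointB μ (z i) b e = δ := by
      simp only [← Finset.mul_sum]
      have h4 : ∑ i, ∑ b, ∑ e, jointB μ (z i) b e = 1 := by
        have h5 : ∀ i, ∑ b, ∑ e, jointB μ (z i) b e = ∑ a, z i a * probA μ a := fun i => by
          rw [← sum_jointE, Finset.sum_comm]
          rfl
        rw [Finset.sum_congr rfl fun i _ => h5 i, Finset.sum_comm]
        simp only [← Finset.sum_mul, hz1a, one_mul, sum_probA]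
      rw [h4, mul_one]
    refine (Finset.sum_le_sum fun i _ => Finset.sum_le_sum fun b _ => h1 i b).trans ?_
    simp only [Finset.sum_add_distrib, h3]
    linarith
  · intro p1
    refine ⟨lik p1, fun a => (hlik0 p1 a).le, ?_, ?_, fun b hb => ?_⟩
    · obtain ⟨a, -, ha⟩ := Finset.exists_lt_of_sum_lt (f := fun _ => (0 : ℝ))
        (g := fun a => probA μ a) (s := Finset.univ) (by simp [sum_probA])
      exact ⟨a, ha, hlik0 p1 a⟩
    · rintro ⟨a', -, ha'⟩ a
      have hex : ∃ i, post μ (z i) = p1 := by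
        by_contra h
        push Not at h
        rw [hσ1w, Finset.sum_eq_zero fun i _ => if_neg (h i)] at ha'
        exact lt_irrefl _ ha'
      obtain ⟨i, hi⟩ := hex
      rw [hlikz p1 i hi, hσ1w, Finset.sum_eq_single i, if_pos hi]
      · intro j _ hj
        rw [if_neg]
        intro h
        exact hj (hinj (h.trans hi.symm))
      · simp
    · exact isBayesUpdate_normalizeVec (fun a => probAB_nonneg μ a b) (hlik0' p1)
        (sum_probAB_mul_pos (hlik0 p1) hb)
  · intro p1 p2
    refine ⟨lik2 p1 p2, hlik20 p1 p2, ?_, ?_, fun a ha =>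
      isBayesUpdate_aliceBelief ha (hlik20 p1 p2)⟩
    · by_cases h : ∃ b, 0 < probB μ b ∧ 0 < (σ2 b p1).weights p2
      · simpa only [hlik2, if_pos h] using h
      · simp only [hlik2, if_neg h]
        have h1 : ∑ b, probB μ b = 1 := by
          simp only [← sum_probAB_left]
          rw [Finset.sum_comm]
          simp only [sum_probAB_right, sum_probA]
        obtain ⟨b, -, hb⟩ := Finset.exists_lt_of_sum_lt (f := fun _ => (0 : ℝ))
          (g := fun b => probB μ b) (s := Finset.univ) (by simp [h1])
        exact ⟨b, hb, one_pos⟩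
    · intro h b
      simp only [hlik2, if_pos h]
  · intro b hb p1 q
    have hT := sum_probAB_mul_pos (hlik0 p1) hb
    refine le_of_mul_le_mul_left ?_ hT
    rw [mul_add, mul_interimBob (hlik0' p1), mul_interimBob (hlik0' p1)]
    have h1 := hR.sum_jointB_mul_expect_le (hlik0' p1) (hr p1 b) p1 q
    rw [sum_jointB] at h1
    have h2 := mul_le_mul_of_nonneg_right hδε hT.le
    simp only [hσ2, Lottery.expect_single]
    linarith
  · intro a _ p1 p2 q
    have h1 := hR.interimAlice3_le (μ := μ) p0 a p1 p2 (α a p1 p2) q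
    have h2 : 0 ≤ ε := hδ.le.trans hδε
    simp only [hσ3]
    linarith

end Equilibrium

end

end ABA

theorem mainTheorem1 {E A B S : Type*} [Fintype E] [Nonempty E] [Fintype A] [Fintype B]
    (μ : ABA.ProbVec (E × A × B)) (R : ABA.ProbVec E → E → ℝ) (p0 : ABA.ProbVec E)
    (hR : ABA.StrictlyProper R)
    (G : (E → ℝ) → ℝ) (hG : ∀ w : ABA.ProbVec E, G w = ABA.expScore R w w)
    (hGdiff : DifferentiableOn ℝ G (stdSimplex ℝ E))
    (πopt : ABA.SignalingScheme μ S) (hopt : ABA.IsOptimalScheme R πopt)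
    (ε : ℝ) (hε : 0 < ε) :
    ∃ (σ1 : ABA.Strategy1 E A) (σ3 : ABA.Strategy3 E A) (σ2 : ABA.Strategy2 E B)
      (β : B → ABA.ProbVec E → ABA.ProbVec A) (α : A → ABA.ProbVec E → ABA.ProbVec E → ABA.ProbVec B),
      ABA.IsEpsPBE μ R p0 ε σ1 σ3 σ2 β α ∧
      ∃ π : ABA.SignalingScheme μ S, ABA.PlaysScheme σ1 π ∧ ABA.schemeDist π πopt ≤ ε := by
  classical
  have hreg : ABA.RegularScore R := ABA.regularScore_of_differentiableOn hR hG hGdiff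
  obtain ⟨l, hl, htight⟩ := hreg.exists_price_of_isOptimalScheme πopt hopt
  -- `δ` is small enough for every type of positive probability, conditional on her signal
  obtain ⟨δ, hδ0, hδε, hδA⟩ : ∃ δ : ℝ, 0 < δ ∧ δ ≤ ε ∧
      ∀ a, 0 < ABA.probA μ a → ((Fintype.card A : ℝ) + 3) * δ ≤ ε * ABA.probA μ a := by
    have h1 : ∀ᶠ δ : ℝ in nhdsWithin 0 (Set.Ioi 0), δ ≤ ε ∧
        ∀ a, 0 < ABA.probA μ a → ((Fintype.card A : ℝ) + 3) * δ ≤ ε * ABA.probA μ a := by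
      refine nhdsWithin_le_nhds ((eventually_le_nhds hε).and (Filter.eventually_all.2 fun a => ?_))
      by_cases ha : 0 < ABA.probA μ a
      · filter_upwards [eventually_le_nhds (show 0 < ε * ABA.probA μ a / ((Fintype.card A : ℝ) + 3)
          by positivity)] with δ hδ _
        rwa [le_div_iff₀ (by positivity), mul_comm] at hδ
      · exact Filter.Eventually.of_forall fun δ h => absurd h ha
    obtain ⟨δ, ⟨h2, h3⟩, h4⟩ := (h1.and self_mem_nhdsWithin).exists
    exact ⟨δ, h4, h2, h3⟩
  obtain ⟨ι, z, hz, hz1, hinj, hdev, hgain, t, c, y, hy0, hyt, hypost, hysum, D, hD, hDsum⟩ :=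
    hreg.exists_fullSupport_scheme hl πopt.likelihood_nonneg πopt.hasSum_likelihood htight
      (fun s hs => πopt.sum_jointE_likelihood_pos hs) hδ0
  obtain ⟨σ1, σ3, σ2, β, α, hPBE, hσ1⟩ :=
    hreg.exists_isEpsPBE p0 hl hz hz1 hinj hδ0 hdev hgain hδε hδA
  have hfiber : ∀ (p : ABA.ProbVec E) (a : A),
      ∑ s ∈ t, (if ABA.post μ (z (c s)) = p then y s a else 0) =
        ∑ i, if ABA.post μ (z i) = p then z i a else 0 := by
    intro p a
    have h1 : ∀ i, (if ABA.post μ (z i) = p then z i a else 0) =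
        ∑ s ∈ t, if c s = i then (if ABA.post μ (z (c s)) = p then y s a else 0) else 0 := by
      intro i
      by_cases hp : ABA.post μ (z i) = p
      · have h2 := congrFun (hysum i) a
        rw [Finset.sum_apply] at h2
        rw [if_pos hp, ← h2]
        refine Finset.sum_congr rfl fun s _ => ?_
        by_cases hs : c s = i
        · rw [if_pos hs, if_pos hs, hs, if_pos hp]
        · rw [if_neg hs, if_neg hs, Pi.zero_apply]
      · rw [if_neg hp]
        refine (Finset.sum_eq_zero fun s _ => ?_).symm
        by_cases hs : c s = i
        · rw [if_pos hs, hs, if_neg hp]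
        · rw [if_neg hs]
    rw [Finset.sum_congr rfl fun i _ => h1 i, Finset.sum_comm]
    exact Finset.sum_congr rfl fun s _ => by simp
  have hsum : ∀ a, HasSum (fun s => y s a) 1 := by
    intro a
    have h1 : ∑ s ∈ t, y s a = 1 := by
      have h2 := congrFun hz1 a
      rw [Finset.sum_apply, Pi.one_apply] at h2
      rw [← h2]
      have h3 : ∀ i, z i a = ∑ s ∈ t, if c s = i then y s a else 0 := fun i => by
        rw [← hysum i, Finset.sum_apply]
        exact Finset.sum_congr rfl fun s _ => by split_ifs <;> rfl
      rw [Finset.sum_congr rfl fun i _ => h3 i, Finset.sum_comm]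
      exact Finset.sum_congr rfl fun s _ => by simp
    rw [← h1]
    exact hasSum_sum_of_ne_finset_zero fun s hs => by rw [hyt s hs, Pi.zero_apply]
  set π := ABA.SignalingScheme.ofLikelihood μ y hy0 hsum with hπ
  have hprob : ∀ s a, π.prob s a = ABA.probA μ a * y s a := fun _ _ => rfl
  refine ⟨σ1, σ3, σ2, β, α, hPBE, π, fun a ha p => ?_, ?_⟩
  · have h1 : (σ1 a).weights p =
        ∑ s ∈ t, if π.postS s = p then π.prob s a / ABA.probA μ a else 0 := by
      have h2 := hfiber p a
      rw [hσ1 a p]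
      refine Eq.trans ?_ (h2.symm.trans (Finset.sum_congr rfl fun s hs => ?_))
      · congr
      · rw [π.postS_eq hprob, hypost s hs, hprob, mul_div_cancel_left₀ _ ha.ne']
    have h3 : HasSum (fun s => if π.postS s = p then π.prob s a / ABA.probA μ a else 0)
        (∑ s ∈ t, if π.postS s = p then π.prob s a / ABA.probA μ a else 0) :=
      hasSum_sum_of_ne_finset_zero fun s hs => by
        rw [hprob, hyt s hs]
        simp
    rw [← h1] at h3
    convert h3
  · have hle : ∀ s, ∑ a, |π.prob s a - πopt.prob s a| ≤ ∑ a, |y s a - πopt.likelihood s a| := by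
      intro s
      refine Finset.sum_le_sum fun a _ => ?_
      rw [hprob, πopt.prob_eq_mul_likelihood, ← mul_sub, abs_mul,
        abs_of_nonneg (ABA.probA_nonneg μ a)]
      exact mul_le_of_le_one_left (abs_nonneg _) (ABA.probA_le_one μ a)
    have hs : Summable fun s => ∑ a, |π.prob s a - πopt.prob s a| :=
      Summable.of_nonneg_of_le (fun s => Finset.sum_nonneg fun a _ => abs_nonneg _) hle
        hDsum.summable
    exact (hasSum_le hle hs.hasSum hDsum).trans (hD.trans hδε)
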